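/- **Setting.** Let $E\subset\mathbb R^d$ be closed and unbounded, endowed with a non-negative Radon measure $m$ with $m(O)\neq 0$ for every non-empty relatively open $O\subset E$. Let $(X(t))_{t\ge 0}$ be a strong Markov process on $E$ whose sample paths are right continuous with left limits; $\mathbb P_x$ is its law when $X(0)=x$. The *spectral radius* $r^*$ is the infimum of all $r>0$ such that for every compact $W\subset E$ the function $x\mapsto\int_0^\infty r^{-t}\,\mathbb P_x(X(t)\in W)\,dt$ is $m$-integrable on compact subsets of $E$. Let $\mathcal E$ be the set of all limits $\lim_{a\to\infty}x_a/a$ with $x_a\in E$. For $T>0$ let $D([0,T],\mathbb R^d)$ be the space of right continuous functions with left limits, endowed with the Skorohod metric: $d_S(\phi,\psi)$ is the infimum of the $\varepsilon>0$ for which some strictly increasing continuous map $\lambda$ of $[0,T]$ onto itself satisfies $\sup_{s<t}\bigl|\log\frac{\lambda(t)-\lambda(s)}{t-s}\bigr|\le\varepsilon$ and $\sup_t|\phi(t)-\psi(\lambda(t))|\le\varepsilon$. **Assumption (A).** * $(a_0)$ $E\subset\mathcal E\neq\{0\}$ and $\mathcal E\setminus\{0\}$ is convex. * $(a_1)$ For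 every $T>0$ there is a good rate function $I_{[0,T]}: D([0,T],\mathbb R^d)\to[0,+\infty]$, i.e. for every $c>0$ and every compact $V\subset\mathbb R^d$ the set $\{\phi:\phi(0)\in V,\ I_{[0,T]}(\phi)\le c\}$ is compact, such that the rescaled processes $Z_a(t)=X(at)/a$, $t\in[0,T]$, satisfy the sample path large deviation principle: for every $x\in\mathbb R^d$, every open $\mathcal O$ and every closed $F$ in $D([0,T],\mathbb R^d)$, $$\lim_{\varepsilon\to0}\liminf_{a\to\infty}\inf_{y\in\frac1aE,\ |y-x|<\varepsilon}\tfrac1a\log\mathbb P_{ay}(Z_a\in\mathcal O)\ \ge\ -\inf_{\phi\in\mathcal O,\ \phi(0)=x}I_{[0,T]}(\phi),$$ $$\lim_{\varepsilon\to0}\limsup_{a\to\infty}\sup_{y\in\frac1aE,\ |y-x|<\varepsilon}\tfrac1a\log\mathbb P_{ay}(Z_a\in F)\ \le\ -\inf_{\phi\in F,\ \phi(0)=x}I_{[0,T]}(\phi).$$ * $(a_2)$ There is a measurable function $L:\mathcal E\times\mathbb R^d\to[0,+\infty]$ such that for every $T>0$, $I_{[0,T]}(\phi)=\int_0^T L(\phi(t),\dot\phi(t))\,dt$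 if $\phi:[0,T]\to\mathcal E$ is absolutely continuous, and $I_{[0,T]}(\phi)=+\infty$ otherwise. * $(a_3)$ There are convex functions $l_1,l_2:\mathbb R^d\to[0,+\infty]$ with $l_1(v)\le L(x,v)\le l_2(v)$ for all $x\in\mathcal E$, $v\in\mathbb R^d$, such that $l_2$ is finite in a neighborhood of $0$ and $\lim_{n\to\infty}\inf_{|v|\ge n}l_1(v)/|v|>0$. For $x,y\in\mathcal E$ and $t>0$, let $I(t,x,y)$ be the infimum of $I_{[0,t]}(\phi)$ over all continuous $\phi:[0,t]\to\mathcal E$ with $\phi(0)=x$ and $\phi(t)=y$; let $I^*=I(1,0,0)$, and let $\overline 0$ be the constant path $\overline 0(t)\equiv0$. **Theorem 1.** Under Assumption (A), for all $x,y\in\mathcal E$, $$\log r^*=-I^*=-I_{[0,1]}(\overline 0)=-\limsup_{t\to+\infty}\frac{I(t,x,y)}{t}=-\inf_{\phi(0)=\phi(1)}I_{[0,1]}(\phi),$$ where the last infimum is over all continuous $\phi:[0,1]\to\mathcal E$ with $\phi(0)=\phi(1)$. -/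

import Mathlib

open Set Filter Topology MeasureTheory ProbabilityTheory
open scoped NNReal ENNReal

noncomputable section

/-- Right continuous functions with left limits (at the end points of the time set the one-sided
conditions that make no sense are void). -/
def IsCadlag {ι α : Type*} [TopologicalSpace ι] [Preorder ι] [TopologicalSpace α]
    (f : ι → α) : Prop :=
  ∀ t, ContinuousWithinAt f (Ioi t) t ∧ ∃ l, Tendsto f (𝓝[<] t) (𝓝 l)

/-! ### The Skorohod space `D([0,T], ℝ^d)` -/

/-- The set `D([0,T], ℝ^d)`. -/
structure SkorohodSpace (d : ℕ) (T : ℝ≥0) where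
  toFun : Icc (0 : ℝ) T → EuclideanSpace ℝ (Fin d)
  cadlag : IsCadlag toFun

namespace SkorohodSpace

variable {d : ℕ} {T : ℝ≥0}

instance : CoeFun (SkorohodSpace d T) fun _ => Icc (0 : ℝ) T → EuclideanSpace ℝ (Fin d) :=
  ⟨toFun⟩

/-- The value `φ(0)`. -/
def start (φ : SkorohodSpace d T) : EuclideanSpace ℝ (Fin d) := φ ⟨0, le_rfl, T.2⟩

/-- The value `φ(T)`. -/
def finish (φ : SkorohodSpace d T) : EuclideanSpace ℝ (Fin d) := φ ⟨T, T.2, le_rfl⟩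

/-- The extension of `φ` to the real line which is constant on `(-∞, 0]` and on `[T, ∞)`. -/
def extend (φ : SkorohodSpace d T) : ℝ → EuclideanSpace ℝ (Fin d) :=
  IccExtend (h := T.2) φ.toFun

/-- The constant path `φ(t) = 0`. -/
def zeroPath (d : ℕ) (T : ℝ≥0) : SkorohodSpace d T where
  toFun _ := 0
  cadlag _ := ⟨continuousWithinAt_const, 0, tendsto_const_nhds⟩

/-- A strictly increasing continuous map `lam` of `[0,T]` onto itself (an order isomorphism) matches
`φ` and `ψ` up to `ε`. -/
def Close (φ ψ : SkorohodSpace d T) (ε : ℝ≥0) : Prop :=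
  ∃ lam : Icc (0 : ℝ) T ≃o Icc (0 : ℝ) T,
    (∀ s t : Icc (0 : ℝ) T, s < t →
      |Real.log (((lam t : ℝ) - lam s) / ((t : ℝ) - s))| ≤ ε) ∧
    ∀ t, dist (φ t) (ψ (lam t)) ≤ ε

theorem Close.refl (φ : SkorohodSpace d T) : Close φ φ 0 := by
  refine ⟨OrderIso.refl _, fun s t h => ?_, fun t => by simp⟩
  have h1 : (t : ℝ) - s ≠ 0 := sub_ne_zero.2 (ne_of_gt h)
  simp [div_self h1]

theorem Close.symm {φ ψ : SkorohodSpace d T} {ε : ℝ≥0} (h : Close φ ψ ε) : Close ψ φ ε := by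
  obtain ⟨lam, h1, h2⟩ := h
  refine ⟨lam.symm, fun s t hst => ?_, fun t => ?_⟩
  · have := h1 (lam.symm s) (lam.symm t) (lam.symm.strictMono hst)
    simp only [OrderIso.apply_symm_apply] at this
    rwa [← inv_div, Real.log_inv, abs_neg]
  · have := h2 (lam.symm t)
    rwa [OrderIso.apply_symm_apply, dist_comm] at this

theorem Close.trans {φ ψ χ : SkorohodSpace d T} {ε δ : ℝ≥0} (h : Close φ ψ ε)
    (h' : Close ψ χ δ) : Close φ χ (ε + δ) := by
  obtain ⟨lam, h1, h2⟩ := h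
  obtain ⟨mu, h3, h4⟩ := h'
  refine ⟨lam.trans mu, fun s t hst => ?_, fun t => ?_⟩
  · have hl : lam s < lam t := lam.strictMono hst
    have hm : mu (lam s) < mu (lam t) := mu.strictMono hl
    have e1 : (0 : ℝ) < (t : ℝ) - s := sub_pos.2 hst
    have e2 : (0 : ℝ) < (lam t : ℝ) - lam s := sub_pos.2 hl
    have e3 : (0 : ℝ) < (mu (lam t) : ℝ) - mu (lam s) := sub_pos.2 hm
    have key : ((mu (lam t) : ℝ) - mu (lam s)) / ((t : ℝ) - s)
        = (((lam t : ℝ) - lam s) / ((t : ℝ) - s)) *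
          (((mu (lam t) : ℝ) - mu (lam s)) / ((lam t : ℝ) - lam s)) := by
      field_simp
    simp only [OrderIso.trans_apply]
    rw [key, Real.log_mul (div_pos e2 e1).ne' (div_pos e3 e2).ne', NNReal.coe_add]
    exact (abs_add_le _ _).trans (add_le_add (h1 s t hst) (h3 _ _ hl))
  · rw [NNReal.coe_add]
    exact (dist_triangle _ (ψ (lam t)) _).trans (add_le_add (h2 t) (h4 (lam t)))

/-- The Skorohod distance: the infimum of all `ε` for which the two paths match up to `ε`. -/
def skorohodDist (φ ψ : SkorohodSpace d T) : ℝ≥0∞ :=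
  ⨅ (ε : ℝ≥0) (_ : Close φ ψ ε), (ε : ℝ≥0∞)

theorem skorohodDist_self (φ : SkorohodSpace d T) : skorohodDist φ φ = 0 :=
  le_antisymm (iInf₂_le_of_le (0 : ℝ≥0) (Close.refl φ) (by simp)) bot_le

theorem skorohodDist_comm (φ ψ : SkorohodSpace d T) : skorohodDist φ ψ = skorohodDist ψ φ := by
  have h : ∀ ε, Close φ ψ ε ↔ Close ψ φ ε := fun ε => ⟨Close.symm, Close.symm⟩
  simp only [skorohodDist, h]

theorem skorohodDist_triangle (φ ψ χ : SkorohodSpace d T) :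
    skorohodDist φ χ ≤ skorohodDist φ ψ + skorohodDist ψ χ := by
  refine le_of_forall_gt fun c hc => ?_
  obtain ⟨u, hu, v, hv, huv⟩ := ENNReal.exists_add_lt_of_add_lt hc
  simp only [gt_iff_lt, skorohodDist, iInf_lt_iff] at hu hv
  obtain ⟨ε, hε, h1⟩ := hu
  obtain ⟨δ, hδ, h2⟩ := hv
  refine lt_of_le_of_lt (iInf₂_le (ε + δ) (hε.trans hδ)) (lt_of_le_of_lt ?_ huv)
  rw [ENNReal.coe_add]
  exact add_le_add h1.le h2.le

/-- `D([0,T], ℝ^d)` carries the Skorohod distance and the topology induced by it. -/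
instance : PseudoEMetricSpace (SkorohodSpace d T) where
  edist := skorohodDist
  edist_self := skorohodDist_self
  edist_comm := skorohodDist_comm
  edist_triangle := skorohodDist_triangle

end SkorohodSpace

/-! ### Strong Markov processes with values in `E` -/

/-- A strong Markov process on `E` with càdlàg paths: the coordinates `X t`, the laws `law x` of the
process started at `x`, and the strong Markov property at stopping times `τ` of the filtration
generated by the process,
`P_x(A, τ < ∞, X(τ + t) ∈ B) = E_x(P_{X(τ)}(X(t) ∈ B); A, τ < ∞)` for `A ∈ F_τ`. -/
structure StrongMarkovProcess {d : ℕ} (E : Set (EuclideanSpace ℝ (Fin d)))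
    (Ω : Type*) [MeasurableSpace Ω] where
  X : ℝ≥0 → Ω → E
  measurable_X : ∀ t, Measurable (X t)
  cadlag : ∀ ω, IsCadlag fun t => X t ω
  law : Kernel E Ω
  isMarkovKernel_law : IsMarkovKernel law
  start : ∀ x, ∀ᵐ ω ∂(law x), X 0 ω = x
  strong_markov : ∀ (x : E) (τ : Ω → WithTop ℝ≥0)
    (hτ : IsStoppingTime
      (Filtration.natural X fun t => (measurable_X t).stronglyMeasurable) τ)
    (A : Set Ω), MeasurableSet[hτ.measurableSpace] A →
    ∀ (t : ℝ≥0) (B : Set E), MeasurableSet B →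
      law x (A ∩ {ω | τ ω < ⊤ ∧ X ((τ ω).untopD 0 + t) ω ∈ B}) =
        ∫⁻ ω in A ∩ {ω | τ ω < ⊤}, law (X ((τ ω).untopD 0) ω) {ω' | X t ω' ∈ B} ∂(law x)

namespace StrongMarkovProcess

variable {d : ℕ} {E : Set (EuclideanSpace ℝ (Fin d))} {Ω : Type*} [MeasurableSpace Ω]

/-- The path `Z_a(t) = X(a t) / a`, `0 ≤ t ≤ T`, of the rescaled process (of interest for `a > 0`
only). -/
def rescaled (Y : StrongMarkovProcess E Ω) (a : ℝ) (T : ℝ≥0) (ω : Ω) : SkorohodSpace d T where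
  toFun t := a⁻¹ • (Y.X (a * t).toNNReal ω : EuclideanSpace ℝ (Fin d))
  cadlag t := by
    rcases le_or_gt a 0 with ha | ha
    · have h : ∀ s : Icc (0 : ℝ) T, (a * (s : ℝ)).toNNReal = 0 := fun s =>
        Real.toNNReal_of_nonpos (mul_nonpos_of_nonpos_of_nonneg ha s.2.1)
      simp only [h]
      exact ⟨continuousWithinAt_const, _, tendsto_const_nhds⟩
    · have hc : Continuous fun s : Icc (0 : ℝ) T => (a * (s : ℝ)).toNNReal := by fun_prop
      have hm : StrictMono fun s : Icc (0 : ℝ) T => (a * (s : ℝ)).toNNReal := by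
        intro s u hsu
        have hu : 0 < (u : ℝ) := lt_of_le_of_lt s.2.1 hsu
        exact (Real.toNNReal_lt_toNNReal_iff (mul_pos ha hu)).2
          (mul_lt_mul_of_pos_left (show (s : ℝ) < u from hsu) ha)
      obtain ⟨h1, l, h2⟩ := Y.cadlag ω (a * (t : ℝ)).toNNReal
      refine ⟨?_, a⁻¹ • (l : EuclideanSpace ℝ (Fin d)), ?_⟩
      · have g : Tendsto (fun s : Icc (0 : ℝ) T => (a * (s : ℝ)).toNNReal) (𝓝[>] t)
            (𝓝[>] (a * (t : ℝ)).toNNReal) :=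
          tendsto_nhdsWithin_iff.2 ⟨hc.continuousAt.mono_left nhdsWithin_le_nhds,
            eventually_nhdsWithin_of_forall fun s hs => hm hs⟩
        exact ((continuous_subtype_val.tendsto _).comp (h1.tendsto.comp g)).const_smul a⁻¹
      · have g : Tendsto (fun s : Icc (0 : ℝ) T => (a * (s : ℝ)).toNNReal) (𝓝[<] t)
            (𝓝[<] (a * (t : ℝ)).toNNReal) :=
          tendsto_nhdsWithin_iff.2 ⟨hc.continuousAt.mono_left nhdsWithin_le_nhds,
            eventually_nhdsWithin_of_forall fun s hs => hm hs⟩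
        exact ((continuous_subtype_val.tendsto _).comp (h2.comp g)).const_smul a⁻¹

/-- The resolvent function `R_r 1_W(x) = ∫_0^∞ r^{-t} P_x(X(t) ∈ W) dt`. -/
def resolvent (Y : StrongMarkovProcess E Ω) (r : ℝ) (W : Set E) (x : E) : ℝ≥0∞ :=
  ∫⁻ t in Ioi (0 : ℝ), ENNReal.ofReal (r ^ (-t)) * Y.law x {ω | Y.X t.toNNReal ω ∈ W}

/-- The spectral radius: the infimum of all `r > 0` for which `R_r 1_W` is `m`-integrable on
compact sets for every compact set `W` (with the convention `inf ∅ = +∞`). -/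
def spectralRadius (Y : StrongMarkovProcess E Ω) (m : Measure E) : ℝ≥0∞ :=
  ⨅ (r : ℝ) (_ : 0 < r ∧ ∀ W : Set E, IsCompact W → ∀ K : Set E, IsCompact K →
    ∫⁻ x in K, Y.resolvent r W x ∂m < ∞), ENNReal.ofReal r

end StrongMarkovProcess

/-! ### Sample path large deviations -/

/-- The set of all limits `lim_{a → ∞} x_a / a` with `x_a ∈ E`. -/
def limitCone {d : ℕ} (E : Set (EuclideanSpace ℝ (Fin d))) :
    Set (EuclideanSpace ℝ (Fin d)) :=
  {z | ∃ x : ℝ → EuclideanSpace ℝ (Fin d), (∀ a, x a ∈ E) ∧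
    Tendsto (fun a : ℝ => a⁻¹ • x a) atTop (𝓝 z)}

/-- Good rate functions on `D([0,T], ℝ^d)`. -/
def IsGoodRateFunction {d : ℕ} {T : ℝ≥0} (I : SkorohodSpace d T → ℝ≥0∞) : Prop :=
  ∀ c : ℝ≥0, 0 < c → ∀ V : Set (EuclideanSpace ℝ (Fin d)), IsCompact V →
    IsCompact {φ : SkorohodSpace d T | φ.start ∈ V ∧ I φ ≤ c}

/-- The sample path large deviation principle in `D([0,T], ℝ^d)` with rate function `I`. The process
is started at `e = a y` with `y ∈ E / a`, `|y - x| < ε`. The inner expressions are monotone in `ε`,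
so that the outer `liminf` and `limsup` are limits as `ε → 0`. -/
structure SamplePathLDP {d : ℕ} {E : Set (EuclideanSpace ℝ (Fin d))} {Ω : Type*}
    [MeasurableSpace Ω] (Y : StrongMarkovProcess E Ω) (T : ℝ≥0)
    (I : SkorohodSpace d T → ℝ≥0∞) : Prop where
  lower : ∀ (x : EuclideanSpace ℝ (Fin d)) (O : Set (SkorohodSpace d T)), IsOpen O →
    -((⨅ (φ : SkorohodSpace d T) (_ : φ ∈ O ∧ φ.start = x), I φ : ℝ≥0∞) : EReal) ≤
      liminf (fun ε : ℝ => liminf (fun a : ℝ =>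
        ⨅ (e : E) (_ : ‖a⁻¹ • (e : EuclideanSpace ℝ (Fin d)) - x‖ < ε),
          ENNReal.log (Y.law e {ω | Y.rescaled a T ω ∈ O}) / (a : EReal)) atTop) (𝓝[>] 0)
  upper : ∀ (x : EuclideanSpace ℝ (Fin d)) (F : Set (SkorohodSpace d T)), IsClosed F →
    limsup (fun ε : ℝ => limsup (fun a : ℝ =>
        ⨆ (e : E) (_ : ‖a⁻¹ • (e : EuclideanSpace ℝ (Fin d)) - x‖ < ε),
          ENNReal.log (Y.law e {ω | Y.rescaled a T ω ∈ F}) / (a : EReal)) atTop) (𝓝[>] 0) ≤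
      -((⨅ (φ : SkorohodSpace d T) (_ : φ ∈ F ∧ φ.start = x), I φ : ℝ≥0∞) : EReal)

open Classical in
/-- The functional `φ ↦ ∫_0^T L(φ(t), φ'(t)) dt` for absolutely continuous `φ : [0,T] → C`,
and `+∞` for all other `φ`. -/
def integralFunctional {d : ℕ} (C : Set (EuclideanSpace ℝ (Fin d)))
    (L : EuclideanSpace ℝ (Fin d) → EuclideanSpace ℝ (Fin d) → ℝ≥0∞) {T : ℝ≥0}
    (φ : SkorohodSpace d T) : ℝ≥0∞ :=
  if AbsolutelyContinuousOnInterval φ.extend 0 T ∧ ∀ t, φ t ∈ C then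
    ∫⁻ t in Icc (0 : ℝ) T, L (φ.extend t) (deriv φ.extend t)
  else ∞

/-- Assumption (A), for the process `Y` and the rate functions `I T` on `D([0,T], ℝ^d)`. -/
structure LargeDeviationAssumption {d : ℕ} {E : Set (EuclideanSpace ℝ (Fin d))} {Ω : Type*}
    [MeasurableSpace Ω] (Y : StrongMarkovProcess E Ω)
    (I : (T : ℝ≥0) → SkorohodSpace d T → ℝ≥0∞) : Prop where
  subset_cone : E ⊆ limitCone E
  cone_ne : limitCone E ≠ {0}
  convex_cone : Convex ℝ (limitCone E \ {0})
  good : ∀ T : ℝ≥0, 0 < T → IsGoodRateFunction (I T)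
  ldp : ∀ T : ℝ≥0, 0 < T → SamplePathLDP Y T (I T)
  integral_form : ∃ L : EuclideanSpace ℝ (Fin d) → EuclideanSpace ℝ (Fin d) → ℝ≥0∞,
    (Measurable fun p : limitCone E × EuclideanSpace ℝ (Fin d) => L p.1 p.2) ∧
    (∀ T : ℝ≥0, 0 < T → ∀ φ, I T φ = integralFunctional (limitCone E) L φ) ∧
    ∃ l₁ l₂ : EuclideanSpace ℝ (Fin d) → ℝ≥0∞,
      ConvexOn ℝ≥0 univ l₁ ∧ ConvexOn ℝ≥0 univ l₂ ∧
      (∀ x ∈ limitCone E, ∀ v, l₁ v ≤ L x v ∧ L x v ≤ l₂ v) ∧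
      (∀ᶠ v in 𝓝 0, l₂ v ≠ ∞) ∧
      ∃ ℓ : ℝ≥0∞, 0 < ℓ ∧
        Tendsto (fun n : ℕ => ⨅ (v : EuclideanSpace ℝ (Fin d)) (_ : (n : ℝ) ≤ ‖v‖),
          l₁ v / ENNReal.ofReal ‖v‖) atTop (𝓝 ℓ)

/-- `I(t,x,y)`: the infimum of the rate function over the continuous `φ : [0,t] → C` with
`φ(0) = x` and `φ(t) = y`. -/
def minimalAction {d : ℕ} (C : Set (EuclideanSpace ℝ (Fin d)))
    (I : (T : ℝ≥0) → SkorohodSpace d T → ℝ≥0∞) (t : ℝ≥0)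
    (x y : EuclideanSpace ℝ (Fin d)) : ℝ≥0∞ :=
  ⨅ (φ : SkorohodSpace d t)
    (_ : Continuous φ.toFun ∧ (∀ s, φ s ∈ C) ∧ φ.start = x ∧ φ.finish = y), I t φ

end

/-! All four quantities equal `L 0 0`, up to sign for the logarithm. The heart is that no continuous
loop in the cone costs less than standing still at the origin (`rate_zeroPath_le_of_loop`). The
reason is the self-similarity of the large deviations: `Z_{Na}(t) = Z_a(Nt) / N`. A loop run through
`N` times in a fixed ball, watched at scale `N * a`, is a path of length `T` confined to a ball of
radius `O(1/N)`. The lower bound at scale `a` gives this event probability at least about `exp (-N *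
a * I φ)`; the upper bound at scale `N * a` gives at most about `exp (-N * a * I 0)`, because
goodness of the rate function makes the cost near the zero path almost that of the zero path itself.

Since bounded speeds have bounded cost and the cone is convex, two points are joined by a segment at
a cost independent of the remaining time. Closing a path from `x` to `y` into a loop, or travelling
through the origin and waiting there, shows that `I(t,x,y)` differs from `t * L 0 0` by a bounded
amount (`tendsto_minimalAction_div`).

For the spectral radius it suffices that `P_e(X(t) ∈ W)` decays at exponential rate `L 0 0` for
compact sets (`spectralRadius_eq_of_law_bounds`). At scale `t` compact sets shrink to the origin, so
the upper bound concerns paths from `0` ending near `0`, that is, near-loops (`law_mem_compact_le`).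
For the lower bound, the large deviations give a return to a ball of radius `a` after time `a * T`,
uniformly over starting points in that ball, and the Markov property iterates this
(`exists_compact_le_law`). -/

/-! ### Absolute continuity under reparametrization -/

section AbsoluteContinuity

variable {X : Type*} [PseudoMetricSpace X]

theorem AbsolutelyContinuousOnInterval.congr_uIcc {f g : ℝ → X} {a b : ℝ}
    (hf : AbsolutelyContinuousOnInterval f a b) (h : EqOn f g (uIcc a b)) :
    AbsolutelyContinuousOnInterval g a b := by
  rw [absolutelyContinuousOnInterval_iff] at hf ⊢
  intro ε hε
  obtain ⟨δ, hδ, H⟩ := hf ε hε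
  refine ⟨δ, hδ, fun F hF hlt => ?_⟩
  convert H F hF hlt using 1
  refine Finset.sum_congr rfl fun i hi => ?_
  rw [h (hF.1 i hi).1, h (hF.1 i hi).2]

/-- A monotone map keeps intervals disjoint and a 1-Lipschitz map does not increase their total
length, so the same `δ` works. It is applied to clamping maps, which extend a path by constants. -/
theorem AbsolutelyContinuousOnInterval.comp_monotone_lipschitz {f : ℝ → X} {g : ℝ → ℝ}
    {a b c d : ℝ} (hf : AbsolutelyContinuousOnInterval f a b) (hg : Monotone g)
    (hg' : LipschitzWith 1 g) (hm : MapsTo g (uIcc c d) (uIcc a b)) :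
    AbsolutelyContinuousOnInterval (f ∘ g) c d := by
  rw [absolutelyContinuousOnInterval_iff] at hf ⊢
  intro ε hε
  obtain ⟨δ, hδ, H⟩ := hf ε hε
  refine ⟨δ, hδ, fun F hF hlt => ?_⟩
  refine H (F.1, fun i => (g (F.2 i).1, g (F.2 i).2)) ⟨fun i hi => ?_, ?_⟩ ?_
  · exact ⟨hm (hF.1 i hi).1, hm (hF.1 i hi).2⟩
  · intro i hi j hj hij
    have := hF.2 hi hj hij
    simp only [Function.onFun, uIoc, Ioc_disjoint_Ioc] at this ⊢
    simp only [← hg.map_max, ← hg.map_min]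
    exact hg this
  · refine lt_of_le_of_lt (Finset.sum_le_sum fun i _ => ?_) hlt
    simpa using hg'.dist_le_mul (F.2 i).1 (F.2 i).2

end AbsoluteContinuity

/-! ### Continuous paths and their concatenation -/

namespace SkorohodSpace

variable {d : ℕ} {T : ℝ≥0}

/-- The restriction to `[0,T]` of a continuous function on the line. -/
def ofContinuous (T : ℝ≥0) (f : ℝ → EuclideanSpace ℝ (Fin d)) (hf : Continuous f) :
    SkorohodSpace d T where
  toFun t := f t
  cadlag _ := ⟨(hf.comp continuous_subtype_val).continuousWithinAt, _,
    ((hf.comp continuous_subtype_val).tendsto _).mono_left nhdsWithin_le_nhds⟩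

variable {f : ℝ → EuclideanSpace ℝ (Fin d)} {hf : Continuous f}

theorem extend_of_mem (φ : SkorohodSpace d T) {t : ℝ} (ht : t ∈ Icc (0 : ℝ) T) :
    φ.extend t = φ ⟨t, ht⟩ :=
  IccExtend_of_mem _ _ ht

theorem extend_of_nonpos (φ : SkorohodSpace d T) {t : ℝ} (ht : t ≤ 0) : φ.extend t = φ.start :=
  IccExtend_of_le_left _ _ ht

theorem extend_of_ge (φ : SkorohodSpace d T) {t : ℝ} (ht : (T : ℝ) ≤ t) :
    φ.extend t = φ.finish :=
  IccExtend_of_right_le _ _ ht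

theorem extend_ofContinuous : EqOn (ofContinuous T f hf).extend f (Icc 0 T) := fun _ ht =>
  extend_of_mem _ ht

theorem continuous_ofContinuous : Continuous (ofContinuous T f hf).toFun :=
  hf.comp continuous_subtype_val

/-- The open interval matters: at interior points the constant extension and `f` agree in a
neighborhood, hence have the same derivative, while at the end points they may differ. -/
theorem integralFunctional_ofContinuous {C : Set (EuclideanSpace ℝ (Fin d))}
    (L : EuclideanSpace ℝ (Fin d) → EuclideanSpace ℝ (Fin d) → ℝ≥0∞)
    (hac : AbsolutelyContinuousOnInterval f 0 T) (hC : ∀ t ∈ Icc (0 : ℝ) T, f t ∈ C) :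
    integralFunctional C L (ofContinuous T f hf) =
      ∫⁻ t in Ioo (0 : ℝ) T, L (f t) (deriv f t) := by
  rw [integralFunctional, if_pos, setLIntegral_congr Ioo_ae_eq_Icc.symm]
  · refine setLIntegral_congr_fun measurableSet_Ioo fun t ht => ?_
    have h : (ofContinuous T f hf).extend =ᶠ[𝓝 t] f := by
      filter_upwards [Ioo_mem_nhds ht.1 ht.2] with u hu
      exact extend_ofContinuous (Ioo_subset_Icc_self hu)
    simp only [h.deriv_eq, h.self_of_nhds]
  · refine ⟨hac.congr_uIcc ?_, fun t => hC t t.2⟩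
    rw [uIcc_of_le T.coe_nonneg]
    exact fun t ht => (extend_ofContinuous ht).symm

theorem integralFunctional_of_continuous {C : Set (EuclideanSpace ℝ (Fin d))}
    {L : EuclideanSpace ℝ (Fin d) → EuclideanSpace ℝ (Fin d) → ℝ≥0∞} {φ : SkorohodSpace d T}
    (h : integralFunctional C L φ ≠ ∞) :
    AbsolutelyContinuousOnInterval φ.extend 0 T ∧ (∀ t, φ t ∈ C) ∧
      integralFunctional C L φ =
        ∫⁻ t in Ioo (0 : ℝ) T, L (φ.extend t) (deriv φ.extend t) := by
  by_cases hφ : AbsolutelyContinuousOnInterval φ.extend 0 T ∧ ∀ t, φ t ∈ C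
  · rw [integralFunctional, if_pos hφ, setLIntegral_congr Ioo_ae_eq_Icc.symm]
    exact ⟨hφ.1, hφ.2, rfl⟩
  · rw [integralFunctional, if_neg hφ] at h
    exact absurd rfl h

/-- Along the path which follows `φ` and then `ψ`, the functional is at most the sum of its values
along `φ` and `ψ`. -/
theorem exists_concat {s t : ℝ≥0} (ht : 0 < t) {C S : Set (EuclideanSpace ℝ (Fin d))}
    {L : EuclideanSpace ℝ (Fin d) → EuclideanSpace ℝ (Fin d) → ℝ≥0∞}
    (φ : SkorohodSpace d s) (ψ : SkorohodSpace d t) (hφ : Continuous φ.toFun)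
    (hψ : Continuous ψ.toFun) (hφS : ∀ u, φ u ∈ S) (hψS : ∀ u, ψ u ∈ S)
    (h : φ.finish = ψ.start) :
    ∃ χ : SkorohodSpace d (s + t), Continuous χ.toFun ∧ (∀ u, χ u ∈ S) ∧ χ.start = φ.start ∧
      χ.finish = ψ.finish ∧
      integralFunctional C L χ ≤ integralFunctional C L φ + integralFunctional C L ψ := by
  have hφe : Continuous φ.extend := hφ.Icc_extend' (h := s.2)
  have hψe : Continuous ψ.extend := hψ.Icc_extend' (h := t.2)
  -- The constant extensions do the gluing: the bracket vanishes up to time `s`, and after `s` the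
  -- first term is `φ.finish = ψ.start`. Continuity and absolute continuity are then inherited from
  -- a sum, without a case split.
  set f : ℝ → EuclideanSpace ℝ (Fin d) := fun u => φ.extend u + (ψ.extend (u - s) - ψ.start)
    with hfdef
  have hf : Continuous f := by fun_prop
  have e1 : ∀ u ≤ (s : ℝ), f u = φ.extend u := by
    intro u hu
    have : ψ.extend (u - s) = ψ.start := extend_of_nonpos _ (by linarith)
    simp [f, this]
  have e2 : ∀ u, (s : ℝ) ≤ u → f u = ψ.extend (u - s) := by
    intro u hu
    have : φ.extend u = φ.finish := extend_of_ge _ hu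
    simp [f, this, h]
  have hst : ((s + t : ℝ≥0) : ℝ) = s + t := NNReal.coe_add s t
  have hs0 : (0 : ℝ) ≤ s := s.2
  have ht0 : (0 : ℝ) < t := ht
  have memφ : ∀ {u : ℝ}, (s : ℝ) < u → u ≤ s + t → u - s ∈ Icc (0 : ℝ) t := by
    intro u h1 h2
    constructor <;> linarith
  -- Needed for two sets: `S`, prescribed by the statement, and `C`, required for finite cost.
  have hS : ∀ (D : Set (EuclideanSpace ℝ (Fin d))), (∀ u, φ u ∈ D) → (∀ u, ψ u ∈ D) →
      ∀ u ∈ Icc (0 : ℝ) (s + t : ℝ≥0), f u ∈ D := by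
    intro D h1 h2 u hu
    rw [hst] at hu
    rcases le_or_gt u s with hus | hus
    · rw [e1 u hus, extend_of_mem _ ⟨hu.1, hus⟩]; exact h1 _
    · rw [e2 u hus.le, extend_of_mem _ (memφ hus hu.2)]; exact h2 _
  refine ⟨ofContinuous (s + t) f hf, continuous_ofContinuous, fun u => hS S hφS hψS u u.2, ?_, ?_,
    ?_⟩
  · change f 0 = _
    rw [e1 0 hs0, extend_of_mem _ ⟨le_rfl, hs0⟩]; rfl
  · change f ((s + t : ℝ≥0) : ℝ) = _
    rw [hst, e2 _ (by linarith), add_sub_cancel_left, extend_of_mem _ ⟨ht0.le, le_rfl⟩]; rfl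
  by_cases hφt : integralFunctional C L φ = ∞
  · simp [hφt]
  by_cases hψt : integralFunctional C L ψ = ∞
  · simp [hψt]
  obtain ⟨a1, c1, i1⟩ := integralFunctional_of_continuous hφt
  obtain ⟨a2, c2, i2⟩ := integralFunctional_of_continuous hψt
  have A1 : AbsolutelyContinuousOnInterval φ.extend 0 (s + t : ℝ≥0) := by
    have := a1.comp_monotone_lipschitz (c := 0) (d := (s + t : ℝ≥0))
      (g := fun u => max 0 (min s u)) (by intro u v huv; dsimp only; gcongr)
      ((LipschitzWith.id.const_min _).const_max _) (fun u _ => by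
        rw [uIcc_of_le hs0]; exact ⟨le_max_left _ _, max_le hs0 (min_le_left _ _)⟩)
    refine this.congr_uIcc fun u hu => ?_
    rw [uIcc_of_le (NNReal.coe_nonneg _)] at hu
    rcases le_or_gt u s with hus | hus
    · simp [hus, hu.1]
    · simp only [Function.comp, min_eq_left hus.le, max_eq_right hs0]
      rw [extend_of_ge _ hus.le, extend_of_ge _ le_rfl]
  have A2 : AbsolutelyContinuousOnInterval (fun u => ψ.extend (u - s)) 0 (s + t : ℝ≥0) := by
    have := a2.comp_monotone_lipschitz (c := 0) (d := (s + t : ℝ≥0))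
      (g := fun u => max 0 (min t (u - s))) (by intro u v huv; dsimp only; gcongr)
      (((LipschitzWith.of_dist_le_mul (by simp)).const_min _).const_max _) (fun u _ => by
        rw [uIcc_of_le ht0.le]; exact ⟨le_max_left _ _, max_le ht0.le (min_le_left _ _)⟩)
    refine this.congr_uIcc fun u hu => ?_
    rw [uIcc_of_le (NNReal.coe_nonneg _), hst] at hu
    rcases le_or_gt u s with hus | hus
    · simp only [Function.comp, min_eq_right (show u - s ≤ t by linarith),
        max_eq_left (show u - s ≤ 0 by linarith)]
      rw [extend_of_nonpos _ le_rfl, extend_of_nonpos _ (by linarith)]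
    · have := memφ hus hu.2
      simp [this.1, this.2]
  have hac : AbsolutelyContinuousOnInterval f 0 (s + t : ℝ≥0) := by
    refine A1.add (A2.sub ?_)
    exact (LipschitzWith.const (α := ℝ) ψ.start).lipschitzOnWith.absolutelyContinuousOnInterval
  rw [integralFunctional_ofContinuous L hac (hS C c1 c2), i1, i2]
  calc ∫⁻ u in Ioo (0 : ℝ) (s + t : ℝ≥0), L (f u) (deriv f u)
      ≤ ∫⁻ u in Ioo (0 : ℝ) s ∪ Ioc (s : ℝ) (s + t), L (f u) (deriv f u) := by
        rw [hst]
        rcases hs0.eq_or_lt with h0 | h0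
        · refine lintegral_mono_set fun u hu => Or.inr ⟨?_, hu.2.le⟩
          rw [← h0]; exact hu.1
        · rw [← setLIntegral_congr (s := Ioc (0 : ℝ) s ∪ Ioc (s : ℝ) (s + t))
            (Ioo_ae_eq_Ioc.symm.union ae_eq_rfl)]
          exact lintegral_mono_set fun u hu => (le_or_gt u s).imp (fun h => ⟨hu.1, h⟩)
            fun h => ⟨h, hu.2.le⟩
    _ ≤ (∫⁻ u in Ioo (0 : ℝ) s, L (f u) (deriv f u)) +
        ∫⁻ u in Ioc (s : ℝ) (s + t), L (f u) (deriv f u) := lintegral_union_le _ _ _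
    _ = _ := by
      congr 1
      · refine setLIntegral_congr_fun measurableSet_Ioo fun u hu => ?_
        have : f =ᶠ[𝓝 u] φ.extend := by
          filter_upwards [Iio_mem_nhds hu.2] with v hv using e1 v hv.le
        simp only [this.deriv_eq, this.self_of_nhds]
      · rw [setLIntegral_congr Ioo_ae_eq_Ioc.symm]
        have him : (fun u : ℝ => u + s) '' Ioo (0 : ℝ) t = Ioo (s : ℝ) (s + t) := by
          simp [add_comm]
        rw [← him, ← (measurePreserving_add_right volume (s : ℝ)).setLIntegral_comp_emb
          (measurableEmbedding_addRight _)]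
        refine setLIntegral_congr_fun measurableSet_Ioo fun u hu => ?_
        have : f =ᶠ[𝓝 (u + s)] fun v => ψ.extend (v - s) := by
          filter_upwards [Ioi_mem_nhds (show (s : ℝ) < u + s by linarith [hu.1])] with v hv
          exact e2 v (le_of_lt hv)
        simp only [this.deriv_eq, this.self_of_nhds, deriv_comp_sub_const, add_sub_cancel_right]

end SkorohodSpace

/-! ### Subadditivity and elementary bounds of the minimal action -/

section MinimalAction

variable {d : ℕ} {C S : Set (EuclideanSpace ℝ (Fin d))}
  {L : EuclideanSpace ℝ (Fin d) → EuclideanSpace ℝ (Fin d) → ℝ≥0∞}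
  {I : (T : ℝ≥0) → SkorohodSpace d T → ℝ≥0∞}

theorem minimalAction_add_le (hI : ∀ T : ℝ≥0, 0 < T → ∀ φ, I T φ = integralFunctional C L φ)
    {s t : ℝ≥0} (hs : 0 < s) (ht : 0 < t) (x y z : EuclideanSpace ℝ (Fin d)) :
    minimalAction S I (s + t) x z ≤ minimalAction S I s x y + minimalAction S I t y z := by
  rw [minimalAction, minimalAction, minimalAction]
  refine ENNReal.le_iInf₂_add_iInf₂ ?_
  rintro φ ⟨h1, h2, h3, h4⟩ ψ ⟨h5, h6, h7, h8⟩
  obtain ⟨χ, k1, k2, k3, k4, k5⟩ := SkorohodSpace.exists_concat (C := C) (S := S) (L := L)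
    ht φ ψ h1 h5 h2 h6 (h4.trans h7.symm)
  refine (iInf₂_le χ ⟨k1, k2, k3.trans h3, k4.trans h8⟩).trans ?_
  rwa [hI _ (add_pos hs ht), hI _ hs, hI _ ht]

/-- The cost of running repeatedly through loops at `x`. The factor `n + 1` avoids the time horizon
`0`, about which nothing is assumed. -/
theorem minimalAction_nsmul_le (hI : ∀ T : ℝ≥0, 0 < T → ∀ φ, I T φ = integralFunctional C L φ)
    {T : ℝ≥0} (hT : 0 < T) (x : EuclideanSpace ℝ (Fin d)) (n : ℕ) :
    minimalAction S I ((n + 1 : ℕ) * T) x x ≤ (n + 1 : ℕ) * minimalAction S I T x x := by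
  induction n with
  | zero => simp
  | succ n ih =>
    have e1 : ((n + 1 + 1 : ℕ) : ℝ≥0) * T = (n + 1 : ℕ) * T + T := by push_cast; ring
    have e2 : ((n + 1 + 1 : ℕ) : ℝ≥0∞) * minimalAction S I T x x
      = (n + 1 : ℕ) * minimalAction S I T x x + minimalAction S I T x x := by push_cast; ring
    rw [e1, e2]
    refine (minimalAction_add_le hI (mul_pos (by positivity) hT) hT x x x).trans ?_
    gcongr

/-- The segment run at constant speed stays in the convex set `C`, and its speed is at most `ρ`. -/
theorem minimalAction_line_le (hI : ∀ T : ℝ≥0, 0 < T → ∀ φ, I T φ = integralFunctional C L φ)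
    (hC : Convex ℝ C) {A : ℝ≥0∞} {ρ : ℝ}
    (hA : ∀ x ∈ C, ∀ v, ‖v‖ ≤ ρ → L x v ≤ A) {T : ℝ≥0} (hT : 0 < T)
    {x y : EuclideanSpace ℝ (Fin d)} (hx : x ∈ C) (hy : y ∈ C) (hxy : ‖y - x‖ ≤ ρ * T) :
    minimalAction C I T x y ≤ A * T := by
  have hT' : (0 : ℝ) < T := hT
  set v : EuclideanSpace ℝ (Fin d) := (T : ℝ)⁻¹ • (y - x) with hv
  have hTv : (T : ℝ) • v = y - x := by rw [hv, smul_smul, mul_inv_cancel₀ hT'.ne', one_smul]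
  set f : ℝ → EuclideanSpace ℝ (Fin d) := fun t => x + t • v with hfdef
  have hf : Continuous f := by fun_prop
  have hfC : ∀ t ∈ Icc (0 : ℝ) T, f t ∈ C := by
    intro t ht
    have : f t = x + (t / T) • (y - x) := by
      rw [← hTv, smul_smul, div_mul_cancel₀ _ hT'.ne']
    rw [this]
    exact hC.add_smul_sub_mem hx hy ⟨div_nonneg ht.1 hT'.le, (div_le_one hT').2 ht.2⟩
  have hderiv : ∀ t, deriv f t = v := fun t => by
    have : HasDerivAt f ((1 : ℝ) • v) t := ((hasDerivAt_id t).smul_const v).const_add x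
    rw [this.deriv, one_smul]
  have hac : AbsolutelyContinuousOnInterval f 0 T := by
    refine LipschitzOnWith.absolutelyContinuousOnInterval (K := ‖v‖₊)
      (LipschitzWith.of_dist_le_mul fun s t => ?_).lipschitzOnWith
    rw [dist_add_left, dist_eq_norm, ← sub_smul, norm_smul, coe_nnnorm, mul_comm, dist_eq_norm]
  have hvρ : ‖v‖ ≤ ρ := by
    rw [hv, norm_smul, norm_inv, Real.norm_of_nonneg hT'.le, inv_mul_le_iff₀ hT', mul_comm]
    exact hxy
  refine (iInf₂_le (SkorohodSpace.ofContinuous T f hf)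
    ⟨SkorohodSpace.continuous_ofContinuous, fun s => hfC s s.2, (?_ : f 0 = x),
      (?_ : f T = y)⟩).trans ?_
  rotate_left
  · simp [f]
  · simp [f, hTv]
  · rw [hI T hT, SkorohodSpace.integralFunctional_ofContinuous L hac hfC]
    calc ∫⁻ t in Ioo (0 : ℝ) T, L (f t) (deriv f t) ≤ ∫⁻ _ in Ioo (0 : ℝ) T, A :=
          setLIntegral_mono' measurableSet_Ioo fun t ht => by
            rw [hderiv]; exact hA _ (hfC t (Ioo_subset_Icc_self ht)) _ hvρ
      _ = A * T := by simp

theorem rate_zeroPath (hI : ∀ T : ℝ≥0, 0 < T → ∀ φ, I T φ = integralFunctional C L φ)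
    (h0 : (0 : EuclideanSpace ℝ (Fin d)) ∈ C) {T : ℝ≥0} (hT : 0 < T) :
    I T (SkorohodSpace.zeroPath d T) = L 0 0 * T := by
  have h : SkorohodSpace.zeroPath d T
      = SkorohodSpace.ofContinuous T (fun _ => 0) continuous_const := rfl
  rw [hI T hT, h, SkorohodSpace.integralFunctional_ofContinuous L
    (LipschitzWith.const (α := ℝ) (0 : EuclideanSpace ℝ
      (Fin d))).lipschitzOnWith.absolutelyContinuousOnInterval (fun _ _ => h0)]
  simp

theorem minimalAction_zero_le (hI : ∀ T : ℝ≥0, 0 < T → ∀ φ, I T φ = integralFunctional C L φ)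
    (h0 : (0 : EuclideanSpace ℝ (Fin d)) ∈ C) {T : ℝ≥0} (hT : 0 < T) :
    minimalAction C I T 0 0 ≤ L 0 0 * T := by
  rw [← rate_zeroPath hI h0 hT]
  exact iInf₂_le _ ⟨continuous_const, fun _ => h0, rfl, rfl⟩

end MinimalAction

/-! ### The large deviation principle as exponential bounds -/

section LargeDeviations

variable {d : ℕ} {E : Set (EuclideanSpace ℝ (Fin d))} {Ω : Type*} [MeasurableSpace Ω]
  {Y : StrongMarkovProcess E Ω} {T : ℝ≥0} {I : SkorohodSpace d T → ℝ≥0∞}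

theorem ofReal_exp_lt_of_lt_log_div {p : ℝ≥0∞} {a c : ℝ} (ha : 0 < a)
    (h : ((-c : ℝ) : EReal) < ENNReal.log p / (a : EReal)) :
    ENNReal.ofReal (Real.exp (-(c * a))) < p := by
  rw [EReal.lt_div_iff (by exact_mod_cast ha) (EReal.coe_ne_top a)] at h
  rw [← ENNReal.log_lt_log_iff, ← EReal.exp_coe, EReal.log_exp]
  convert h using 1
  rw [← EReal.coe_mul, neg_mul]

theorem lt_ofReal_exp_of_log_div_lt {p : ℝ≥0∞} {a c : ℝ} (ha : 0 < a)
    (h : ENNReal.log p / (a : EReal) < ((-c : ℝ) : EReal)) :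
    p < ENNReal.ofReal (Real.exp (-(c * a))) := by
  rw [EReal.div_lt_iff (by exact_mod_cast ha) (EReal.coe_ne_top a)] at h
  rw [← ENNReal.log_lt_log_iff, ← EReal.exp_coe, EReal.log_exp]
  convert h using 1
  rw [← EReal.coe_mul, neg_mul]

/-- A strict inequality for the iterated limit leaves room to fix one `ε`; the bound is then uniform
over all starting points in the corresponding ball. -/
theorem SamplePathLDP.eventually_exp_le (h : SamplePathLDP Y T I) {x : EuclideanSpace ℝ (Fin d)}
    {O : Set (SkorohodSpace d T)} (hO : IsOpen O) {c : ℝ≥0}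
    (hc : ⨅ (φ : SkorohodSpace d T) (_ : φ ∈ O ∧ φ.start = x), I φ < c) :
    ∃ ε > (0 : ℝ), ∀ᶠ a : ℝ in atTop, ∀ e : E,
      ‖a⁻¹ • (e : EuclideanSpace ℝ (Fin d)) - x‖ < ε →
      ENNReal.ofReal (Real.exp (-(c * a))) ≤ Y.law e {ω | Y.rescaled a T ω ∈ O} := by
  have h1 : ((-(c : ℝ) : ℝ) : EReal) <
      -((⨅ (φ : SkorohodSpace d T) (_ : φ ∈ O ∧ φ.start = x), I φ : ℝ≥0∞) : EReal) := by
    rw [EReal.coe_neg, EReal.neg_lt_neg_iff, ← EReal.coe_nnreal_eq_coe_real]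
    exact EReal.coe_ennreal_lt_coe_ennreal_iff.2 hc
  have h2 := (eventually_lt_of_lt_liminf (h1.trans_le (h.lower x O hO))).and
    self_mem_nhdsWithin
  obtain ⟨ε, hε, hε0⟩ := h2.exists
  refine ⟨ε, hε0, ?_⟩
  filter_upwards [eventually_lt_of_lt_liminf hε, eventually_gt_atTop 0] with a ha ha0 e he
  exact (ofReal_exp_lt_of_lt_log_div ha0 (ha.trans_le (iInf₂_le e he))).le

theorem SamplePathLDP.eventually_le_exp (h : SamplePathLDP Y T I) {x : EuclideanSpace ℝ (Fin d)}
    {F : Set (SkorohodSpace d T)} (hF : IsClosed F) {c : ℝ≥0}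
    (hc : c < ⨅ (φ : SkorohodSpace d T) (_ : φ ∈ F ∧ φ.start = x), I φ) :
    ∃ ε > (0 : ℝ), ∀ᶠ a : ℝ in atTop, ∀ e : E,
      ‖a⁻¹ • (e : EuclideanSpace ℝ (Fin d)) - x‖ < ε →
      Y.law e {ω | Y.rescaled a T ω ∈ F} ≤ ENNReal.ofReal (Real.exp (-(c * a))) := by
  have h1 : -((⨅ (φ : SkorohodSpace d T) (_ : φ ∈ F ∧ φ.start = x), I φ : ℝ≥0∞) : EReal) <
      ((-(c : ℝ) : ℝ) : EReal) := by
    rw [EReal.coe_neg, EReal.neg_lt_neg_iff, ← EReal.coe_nnreal_eq_coe_real]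
    exact EReal.coe_ennreal_lt_coe_ennreal_iff.2 hc
  have h2 := (eventually_lt_of_limsup_lt ((h.upper x F hF).trans_lt h1)).and
    self_mem_nhdsWithin
  obtain ⟨ε, hε, hε0⟩ := h2.exists
  refine ⟨ε, hε0, ?_⟩
  filter_upwards [eventually_lt_of_limsup_lt hε, eventually_gt_atTop 0] with a ha ha0 e he
  exact (lt_ofReal_exp_of_log_div_lt ha0 (lt_of_le_of_lt
    (le_iSup₂ (f := fun (e : E) (_ : ‖a⁻¹ • (e : EuclideanSpace ℝ (Fin d)) - x‖ < ε) =>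
      ENNReal.log (Y.law e {ω | Y.rescaled a T ω ∈ F}) / (a : EReal)) e he) ha)).le

end LargeDeviations

/-! ### Skorohod distance to the zero path and end point evaluation -/

namespace SkorohodSpace

variable {d : ℕ} {T : ℝ≥0}

theorem exists_close_of_edist_lt {φ ψ : SkorohodSpace d T} {r : ℝ≥0∞} (h : edist φ ψ < r) :
    ∃ ε : ℝ≥0, Close φ ψ ε ∧ (ε : ℝ≥0∞) < r := by
  change skorohodDist φ ψ < r at h
  simpa only [skorohodDist, iInf_lt_iff, exists_prop] using h

theorem edist_le_of_close {φ ψ : SkorohodSpace d T} {ε : ℝ≥0} (h : Close φ ψ ε) :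
    edist φ ψ ≤ ε :=
  iInf₂_le ε h

theorem edist_zeroPath_le {φ : SkorohodSpace d T} {r : ℝ≥0} (h : ∀ t, ‖φ t‖ ≤ r) :
    edist φ (zeroPath d T) ≤ r := by
  refine edist_le_of_close ⟨OrderIso.refl _, fun s t hst => ?_, fun t => ?_⟩
  · have h1 : (t : ℝ) - s ≠ 0 := sub_ne_zero.2 (ne_of_gt hst)
    simp [div_self h1]
  · simpa [zeroPath] using h t

/-- A time change does not alter the constant path, so the Skorohod distance to it controls the
uniform norm. -/
theorem enorm_apply_le (φ : SkorohodSpace d T) (t : Icc (0 : ℝ) T) :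
    ‖φ t‖ₑ ≤ edist φ (zeroPath d T) := by
  refine le_of_forall_gt fun r hr => ?_
  obtain ⟨ε, ⟨lam, -, h⟩, hε⟩ := exists_close_of_edist_lt hr
  refine lt_of_le_of_lt ?_ hε
  have := h t
  simp only [zeroPath, dist_zero_right] at this
  rw [← ofReal_norm, ← ENNReal.ofReal_coe_nnreal]
  exact ENNReal.ofReal_le_ofReal this

theorem eq_zeroPath_of_edist_eq_zero {φ : SkorohodSpace d T}
    (h : edist φ (zeroPath d T) = 0) : φ = zeroPath d T := by
  have : φ.toFun = fun _ => 0 := funext fun t => by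
    simpa [h] using enorm_apply_le φ t
  cases φ
  cases this
  rfl

/-- Every order isomorphism of `[0,T]` fixes `T`, so evaluation at the end point is 1-Lipschitz,
unlike evaluation at interior times. -/
theorem edist_finish_le (φ ψ : SkorohodSpace d T) : edist φ.finish ψ.finish ≤ edist φ ψ := by
  refine le_of_forall_gt fun r hr => ?_
  obtain ⟨ε, ⟨lam, -, h⟩, hε⟩ := exists_close_of_edist_lt hr
  refine lt_of_le_of_lt ?_ hε
  set p : Icc (0 : ℝ) T := ⟨T, T.2, le_rfl⟩ with hp
  have hmax : ∀ q : Icc (0 : ℝ) T, q ≤ p := fun q => q.2.2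
  have hlam : lam p = p := le_antisymm (hmax _) (by
    have := lam.monotone (hmax (lam.symm p)); rwa [lam.apply_symm_apply] at this)
  have := h p
  rw [hlam] at this
  rw [edist_dist, ← ENNReal.ofReal_coe_nnreal]
  exact ENNReal.ofReal_le_ofReal this

theorem continuous_finish : Continuous (finish : SkorohodSpace d T → EuclideanSpace ℝ (Fin d)) :=
  (LipschitzWith.of_edist_le edist_finish_le).continuous

end SkorohodSpace

/-! ### The limit cone -/

section Cone

variable {d : ℕ} {E : Set (EuclideanSpace ℝ (Fin d))}

theorem mem_limitCone_iff {z : EuclideanSpace ℝ (Fin d)} (hne : E.Nonempty) :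
    z ∈ limitCone E ↔ ∀ ε > (0 : ℝ), ∀ᶠ a : ℝ in atTop, ∃ e ∈ E, ‖a⁻¹ • e - z‖ < ε := by
  constructor
  · rintro ⟨x, hx, hlim⟩ ε hε
    filter_upwards [Metric.tendsto_nhds.1 hlim ε hε] with a ha
    exact ⟨x a, hx a, by rwa [← dist_eq_norm]⟩
  · intro h
    -- One sequence serving all `ε` at once: points of `E` nearest to `a • z` up to an error `1`,
    -- which division by `a` makes negligible.
    have hx : ∀ a : ℝ, ∃ e ∈ E, dist (a • z) e < Metric.infDist (a • z) E + 1 := fun a =>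
      (Metric.infDist_lt_iff hne).1 (lt_add_one _)
    choose x hxE hx using hx
    refine ⟨x, hxE, Metric.tendsto_nhds.2 fun ε hε => ?_⟩
    filter_upwards [h (ε / 2) (half_pos hε), eventually_gt_atTop (max 0 (2 / ε))]
      with a ⟨e, he, hea⟩ ha
    have ha0 : 0 < a := (le_max_left _ _).trans_lt ha
    have ha1 : 1 < a * (ε / 2) := by
      have := (div_lt_iff₀ hε).1 ((le_max_right _ _).trans_lt ha)
      linarith
    have key : ∀ e : EuclideanSpace ℝ (Fin d), a * ‖a⁻¹ • e - z‖ = dist (a • z) e := fun e => by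
      rw [dist_comm, dist_eq_norm]
      nth_rewrite 1 [← Real.norm_of_nonneg ha0.le]
      rw [← norm_smul, smul_sub, smul_smul, mul_inv_cancel₀ ha0.ne', one_smul]
    have h1 := (hx a).trans_le (add_le_add_left (Metric.infDist_le_dist_of_mem he) 1)
    rw [← key, ← key] at h1
    rw [dist_eq_norm]
    have h2 := mul_lt_mul_of_pos_left hea ha0
    exact lt_of_mul_lt_mul_left (by linarith) ha0.le

theorem isClosed_limitCone (hne : E.Nonempty) : IsClosed (limitCone E) := by
  refine isClosed_of_closure_subset fun z hz => (mem_limitCone_iff hne).2 fun ε hε => ?_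
  obtain ⟨w, hw, hzw⟩ := Metric.mem_closure_iff.1 hz (ε / 2) (half_pos hε)
  filter_upwards [(mem_limitCone_iff hne).1 hw (ε / 2) (half_pos hε)] with a ⟨e, he, hea⟩
  refine ⟨e, he, ?_⟩
  rw [← dist_eq_norm] at hea ⊢
  have := dist_triangle (a⁻¹ • e) w z
  rw [dist_comm w z] at this
  linarith

theorem zero_mem_limitCone (hne : E.Nonempty) : (0 : EuclideanSpace ℝ (Fin d)) ∈ limitCone E := by
  obtain ⟨e, he⟩ := hne
  refine ⟨fun _ => e, fun _ => he, ?_⟩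
  simpa using (tendsto_inv_atTop_zero (𝕜 := ℝ)).smul_const e

theorem smul_mem_limitCone {z : EuclideanSpace ℝ (Fin d)} (hz : z ∈ limitCone E) {s : ℝ}
    (hs : 0 ≤ s) : s • z ∈ limitCone E := by
  obtain ⟨x, hx, hlim⟩ := hz
  rcases hs.eq_or_lt with rfl | hs
  · rw [zero_smul]
    exact zero_mem_limitCone ⟨x 0, hx 0⟩
  · refine ⟨fun a => x (s * a), fun a => hx _, ?_⟩
    have := (hlim.comp (tendsto_id.const_mul_atTop hs)).const_smul s
    refine this.congr fun a => ?_
    simp only [Function.comp, id, smul_smul, mul_inv]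
    rw [← mul_assoc, mul_inv_cancel₀ hs.ne', one_mul]

theorem convex_limitCone (h : Convex ℝ (limitCone E \ {0})) : Convex ℝ (limitCone E) := by
  intro x hx y hy a b ha hb hab
  by_cases hx0 : x = 0
  · subst hx0; simpa using smul_mem_limitCone hy hb
  by_cases hy0 : y = 0
  · subst hy0; simpa using smul_mem_limitCone hx ha
  exact (h ⟨hx, hx0⟩ ⟨hy, hy0⟩ ha hb hab).1

end Cone

/-- A convex function with values in `[0,∞]` which is finite near `0` is bounded near `0`. -/
theorem ConvexOn.exists_bound_nhds_zero {V : Type*} [NormedAddCommGroup V] [NormedSpace ℝ V]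
    [FiniteDimensional ℝ V] {l : V → ℝ≥0∞} (hl : ConvexOn ℝ≥0 univ l)
    (hfin : ∀ᶠ v in 𝓝 0, l v ≠ ∞) :
    ∃ ρ > (0 : ℝ), ∃ A : ℝ≥0, ∀ v, ‖v‖ ≤ ρ → l v ≤ A := by
  obtain ⟨r, hr, hball⟩ := Metric.eventually_nhds_iff_ball.1 hfin
  -- On the ball of finiteness `l` becomes a real convex function, and such a function is continuous
  -- on an open set in finite dimension.
  have hconv : ConvexOn ℝ (Metric.ball (0 : V) r) fun v => (l v).toReal := by
    refine ⟨convex_ball _ _, fun x hx y hy a b ha hb hab => ?_⟩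
    lift a to ℝ≥0 using ha
    lift b to ℝ≥0 using hb
    have h := hl.2 (mem_univ x) (mem_univ y) zero_le zero_le (by exact_mod_cast hab)
    have hxt := hball x hx
    have hyt := hball y hy
    have ht : a • l x + b • l y ≠ ∞ :=
      ENNReal.add_ne_top.2 ⟨ENNReal.mul_ne_top ENNReal.coe_ne_top hxt,
        ENNReal.mul_ne_top ENNReal.coe_ne_top hyt⟩
    have h' := ENNReal.toReal_mono ht h
    rw [ENNReal.toReal_add (ENNReal.add_ne_top.1 ht).1 (ENNReal.add_ne_top.1 ht).2,
      ENNReal.smul_def, ENNReal.smul_def, smul_eq_mul, smul_eq_mul, ENNReal.toReal_mul,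
      ENNReal.toReal_mul] at h'
    exact h'
  have hcont := (hconv.continuousOn Metric.isOpen_ball).continuousAt
    (Metric.ball_mem_nhds (0 : V) hr)
  have hev : ∀ᶠ v in 𝓝 (0 : V), (l v).toReal < (l 0).toReal + 1 :=
    hcont.eventually_lt_const (lt_add_one _)
  obtain ⟨r', hr', hball'⟩ := Metric.eventually_nhds_iff_ball.1 (hev.and hfin)
  refine ⟨r' / 2, half_pos hr', (l 0).toNNReal + 1, fun v hv => ?_⟩
  obtain ⟨h1, h2⟩ := hball' v (by rw [mem_ball_zero_iff]; linarith)
  rw [← ENNReal.ofReal_toReal h2, ← ENNReal.ofReal_coe_nnreal]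
  exact ENNReal.ofReal_le_ofReal h1.le

theorem IsCompact.exists_pos_lt_of_continuous {α : Type*} [TopologicalSpace α] {K : Set α}
    (hK : IsCompact K) {f : α → ℝ≥0∞} (hf : Continuous f) (hpos : ∀ x ∈ K, f x ≠ 0) :
    ∃ δ : ℝ≥0, 0 < δ ∧ ∀ x ∈ K, δ < f x := by
  rcases K.eq_empty_or_nonempty with rfl | hne
  · exact ⟨1, one_pos, by simp⟩
  obtain ⟨x₀, hx₀, hmin⟩ := hK.exists_isMinOn hne hf.continuousOn
  obtain ⟨δ, h0, hδ⟩ := ENNReal.lt_iff_exists_nnreal_btwn.1 (pos_iff_ne_zero.2 (hpos x₀ hx₀))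
  exact ⟨δ, by exact_mod_cast h0, fun x hx => hδ.trans_le (hmin hx)⟩

/-! ### Loops and the growth of the minimal action -/

namespace LargeDeviationAssumption

variable {d : ℕ} {E : Set (EuclideanSpace ℝ (Fin d))} {Ω : Type*} [MeasurableSpace Ω]
  {Y : StrongMarkovProcess E Ω} {I : (T : ℝ≥0) → SkorohodSpace d T → ℝ≥0∞}

theorem exists_lagrangian (hA : LargeDeviationAssumption Y I) :
    ∃ L : EuclideanSpace ℝ (Fin d) → EuclideanSpace ℝ (Fin d) → ℝ≥0∞,
      (∀ T : ℝ≥0, 0 < T → ∀ φ, I T φ = integralFunctional (limitCone E) L φ) ∧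
      ∃ ρ > (0 : ℝ), ∃ A : ℝ≥0, ∀ x ∈ limitCone E, ∀ v, ‖v‖ ≤ ρ → L x v ≤ A := by
  obtain ⟨L, -, hI, l₁, l₂, -, hl, hLl, hfin, -⟩ := hA.integral_form
  obtain ⟨ρ, hρ, A, hb⟩ := hl.exists_bound_nhds_zero hfin
  exact ⟨L, hI, ρ, hρ, A, fun x hx v hv => (hLl x hx v).2.trans (hb v hv)⟩

/-- Among the loops, the constant path at `0` minimizes the rate function. -/
theorem rate_zeroPath_le_of_loop (hA : LargeDeviationAssumption Y I) (hne : E.Nonempty)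
    {T : ℝ≥0} (hT : 0 < T) {φ : SkorohodSpace d T} (hφ : Continuous φ.toFun)
    (hφC : ∀ s, φ s ∈ limitCone E) (hloop : φ.start = φ.finish) :
    I T (SkorohodSpace.zeroPath d T) ≤ I T φ := by
  obtain ⟨L, hI, -⟩ := hA.exists_lagrangian
  by_contra! hlt
  -- Three levels `I φ < c₀ < c < c' < I 0`: `c₀` for the lower bound, `c` for the upper bound, and
  -- `c'` for the compact sublevel set, which misses the zero path.
  obtain ⟨c₀, h0, h0'⟩ := ENNReal.lt_iff_exists_nnreal_btwn.1 hlt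
  obtain ⟨c, h1, h1'⟩ := ENNReal.lt_iff_exists_nnreal_btwn.1 h0'
  obtain ⟨c', h2, h2'⟩ := ENNReal.lt_iff_exists_nnreal_btwn.1 h1'
  have hc' : 0 < c' := by
    have : c < c' := by exact_mod_cast h2
    exact lt_of_le_of_lt zero_le this
  -- `δ` must serve every starting point in the unit ball, since it is fixed before `N` and the
  -- starting point `x / N` depends on `N`.
  obtain ⟨δ, hδ, hδK⟩ := (hA.good T hT c' hc' (Metric.closedBall 0 1)
    (isCompact_closedBall _ _)).exists_pos_lt_of_continuous
    (f := fun ψ => edist ψ (SkorohodSpace.zeroPath d T)) (by fun_prop) (by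
      rintro ψ ⟨-, hψ⟩ h
      rw [SkorohodSpace.eq_zeroPath_of_edist_eq_zero h] at hψ
      exact absurd h2' (not_lt.2 hψ))
  set x := φ.start with hx
  have hxC : x ∈ limitCone E := hφC _
  have : CompactSpace (Icc (0 : ℝ) T) := isCompact_iff_compactSpace.1 isCompact_Icc
  obtain ⟨M, hM⟩ := (isCompact_range hφ).isBounded.exists_norm_le
  have hφM : ∀ s, ‖φ s‖ ≤ M := fun s => hM _ (mem_range_self s)
  have hM0 : 0 ≤ M := (norm_nonneg _).trans (hφM ⟨0, le_rfl, T.2⟩)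
  have hxM : ‖x‖ ≤ M := hφM _
  -- `N ≥ M` brings `x / N` into the unit ball; `N ≥ (M + 1) / δ` brings the unit tube around the
  -- repeated loop, scaled by `1 / N`, into the `δ`-ball around the zero path.
  obtain ⟨n, hn⟩ := exists_nat_gt (max M ((M + 1) / δ))
  set N : ℕ := n + 1 with hN
  have hnN : (n : ℝ) < N := by simp [hN]
  have hN0 : (0 : ℝ) < N := by simp [hN]; positivity
  have hNx : M ≤ N := ((le_max_left _ _).trans hn.le).trans hnN.le
  have hNδ : (M + 1) / N ≤ δ := by
    rw [div_le_iff₀ hN0, mul_comm, ← div_le_iff₀ (by exact_mod_cast hδ)]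
    exact ((le_max_right _ _).trans hn.le).trans hnN.le
  have hNT : 0 < (N : ℝ≥0) * T := mul_pos (by exact_mod_cast hN0) hT
  -- a path which runs through the loop `N` times
  have hact : minimalAction (limitCone E ∩ Metric.closedBall 0 M) I (N * T) x x
      < ((N * c₀ : ℝ≥0) : ℝ≥0∞) := by
    refine (minimalAction_nsmul_le hI hT x n).trans_lt ?_
    rw [ENNReal.coe_mul, ENNReal.coe_natCast]
    refine (ENNReal.mul_lt_mul_iff_right (by simp) (by simp)).2 (lt_of_le_of_lt ?_ h0)
    exact iInf₂_le φ ⟨hφ, fun s => ⟨hφC s, by simpa using hφM s⟩, rfl, hloop.symm⟩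
  simp only [minimalAction, iInf_lt_iff] at hact
  obtain ⟨ψ, ⟨hψ, hψS, hψ0, -⟩, hIψ⟩ := hact
  obtain ⟨ε₁, hε₁, hlow⟩ := (hA.ldp _ hNT).eventually_exp_le (x := x)
    (O := Metric.eball ψ 1) Metric.isOpen_eball (c := N * c₀)
    ((iInf₂_le ψ ⟨Metric.mem_eball_self one_pos, hψ0⟩).trans_lt hIψ)
  obtain ⟨ε₂, hε₂, hup⟩ := (hA.ldp T hT).eventually_le_exp (x := (N : ℝ)⁻¹ • x)
    (F := Metric.closedEBall (SkorohodSpace.zeroPath d T) δ) Metric.isClosed_closedEBall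
    (c := c) (by
      refine h2.trans_le (le_iInf₂ fun χ hχ => ?_)
      by_contra! hlt'
      refine absurd (hδK χ ⟨?_, hlt'.le⟩) (not_lt.2 hχ.1)
      rw [hχ.2, mem_closedBall_zero_iff, norm_smul, norm_inv, Real.norm_of_nonneg hN0.le,
        inv_mul_le_iff₀ hN0, mul_one]
      exact hxM.trans hNx)
  have hup' := (tendsto_id.const_mul_atTop hN0).eventually hup
  -- A single starting point `e` admissible at both scales: `e / a` within `ε₁` of `x`, and `e / (N
  -- * a)` within `ε₂` of `x / N`.
  have hex := (mem_limitCone_iff hne).1 hxC (min ε₁ (N * ε₂)) (lt_min hε₁ (mul_pos hN0 hε₂))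
  obtain ⟨a, hlow, hup, ⟨e, heE, he⟩, ha⟩ :=
    (hlow.and (hup'.and (hex.and (eventually_gt_atTop 0)))).exists
  have hl := hlow ⟨e, heE⟩ (he.trans_le (min_le_left _ _))
  have hu := hup ⟨e, heE⟩ (by
    have : (id a * N : ℝ)⁻¹ = (N : ℝ)⁻¹ * a⁻¹ := by rw [mul_inv_rev]; rfl
    rw [mul_comm, this, mul_smul, ← smul_sub, norm_smul, norm_inv, Real.norm_of_nonneg hN0.le,
      inv_mul_lt_iff₀ hN0]
    exact he.trans_le (min_le_right _ _))
  have hsub : {ω | Y.rescaled a (N * T) ω ∈ Metric.eball ψ 1} ⊆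
      {ω | Y.rescaled (N * id a) T ω ∈ Metric.closedEBall (SkorohodSpace.zeroPath d T) δ} := by
    intro ω hω
    obtain ⟨r, ⟨lam, -, hlam⟩, hr⟩ :=
      SkorohodSpace.exists_close_of_edist_lt (Metric.mem_eball.1 hω)
    refine SkorohodSpace.edist_zeroPath_le fun t => ?_
    have ht : (N : ℝ) * t ∈ Icc (0 : ℝ) ((N * T : ℝ≥0) : ℝ) := by
      refine ⟨mul_nonneg hN0.le t.2.1, ?_⟩
      rw [NNReal.coe_mul, NNReal.coe_natCast]
      exact mul_le_mul_of_nonneg_left t.2.2 hN0.le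
    have hval : Y.rescaled (N * id a) T ω t =
        (N : ℝ)⁻¹ • Y.rescaled a (N * T) ω ⟨N * t, ht⟩ := by
      simp only [StrongMarkovProcess.rescaled, smul_smul, mul_inv, id]
      rw [show (N : ℝ) * a * t = a * (N * t) by ring]
    have hψb := (hψS (lam ⟨N * t, ht⟩)).2
    rw [mem_closedBall_zero_iff] at hψb
    have hr1 : (r : ℝ) < 1 := by exact_mod_cast hr
    have hd := hlam ⟨N * t, ht⟩
    have hnorm := norm_le_norm_add_norm_sub' (Y.rescaled a (N * T) ω ⟨N * t, ht⟩)
      (ψ (lam ⟨N * t, ht⟩))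
    rw [← dist_eq_norm] at hnorm
    rw [hval, norm_smul, norm_inv, Real.norm_of_nonneg hN0.le]
    refine le_trans ?_ hNδ
    rw [div_eq_inv_mul]
    gcongr
    linarith
  -- The two bounds give `exp (-N * c₀ * a) ≤ exp (-c * N * a)`, against `c₀ < c`.
  have hle := (hl.trans (measure_mono hsub)).trans hu
  rw [ENNReal.ofReal_le_ofReal_iff (Real.exp_pos _).le, Real.exp_le_exp, neg_le_neg_iff,
    NNReal.coe_mul, NNReal.coe_natCast, id] at hle
  have hcc : (c₀ : ℝ) < c := by exact_mod_cast h1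
  nlinarith [mul_pos (mul_pos hN0 ha) (sub_pos.2 hcc)]

theorem rate_zeroPath_le_minimalAction (hA : LargeDeviationAssumption Y I) (hne : E.Nonempty)
    {T : ℝ≥0} (hT : 0 < T) (x : EuclideanSpace ℝ (Fin d)) :
    I T (SkorohodSpace.zeroPath d T) ≤ minimalAction (limitCone E) I T x x :=
  le_iInf₂ fun _ h => hA.rate_zeroPath_le_of_loop hne hT h.1 h.2.1 (h.2.2.1.trans h.2.2.2.symm)

theorem minimalAction_zero_eq (hA : LargeDeviationAssumption Y I) (hne : E.Nonempty)
    {T : ℝ≥0} (hT : 0 < T) :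
    minimalAction (limitCone E) I T 0 0 = I T (SkorohodSpace.zeroPath d T) :=
  le_antisymm (iInf₂_le _ ⟨continuous_const, fun _ => zero_mem_limitCone hne, rfl, rfl⟩)
    (hA.rate_zeroPath_le_minimalAction hne hT 0)

theorem tendsto_minimalAction_div (hA : LargeDeviationAssumption Y I) (hne : E.Nonempty)
    {x y : EuclideanSpace ℝ (Fin d)} (hx : x ∈ limitCone E) (hy : y ∈ limitCone E) :
    Tendsto (fun t : ℝ≥0 => minimalAction (limitCone E) I t x y / t) atTop
      (𝓝 (I 1 (SkorohodSpace.zeroPath d 1))) := by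
  obtain ⟨L, hI, ρ, hρ, A, hL⟩ := hA.exists_lagrangian
  have h0 := zero_mem_limitCone hne
  have hC := convex_limitCone hA.convex_cone
  have hLt : L 0 0 ≠ ∞ := ne_top_of_le_ne_top ENNReal.coe_ne_top (hL 0 h0 0 (by simpa using hρ.le))
  -- Within time `s` each of the segments `x → 0`, `0 → y` and `y → x` can be run at speed at most
  -- `ρ`.
  obtain ⟨s, hs⟩ := exists_nat_gt ((‖x‖ + ‖y‖) / ρ)
  have hs0 : (0 : ℝ) < s := lt_of_le_of_lt (by positivity) hs
  have hsρ : ‖x‖ + ‖y‖ ≤ ρ * ((s : ℝ≥0) : ℝ) := by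
    rw [NNReal.coe_natCast, mul_comm]; exact ((div_lt_iff₀ hρ).1 hs).le
  have hs' : (0 : ℝ≥0) < s := by exact_mod_cast hs0
  have hx0 := norm_nonneg x
  have hy0 := norm_nonneg y
  have m1 : minimalAction (limitCone E) I s x 0 ≤ A * (s : ℝ≥0) :=
    minimalAction_line_le hI hC hL hs' hx h0 (by simp only [zero_sub, norm_neg]; linarith)
  have m2 : minimalAction (limitCone E) I s 0 y ≤ A * (s : ℝ≥0) :=
    minimalAction_line_le hI hC hL hs' h0 hy (by simp only [sub_zero]; linarith)
  have m3 : minimalAction (limitCone E) I s y x ≤ A * (s : ℝ≥0) :=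
    minimalAction_line_le hI hC hL hs' hy hx ((norm_sub_le _ _).trans hsρ)
  rw [rate_zeroPath hI h0 one_pos, ENNReal.coe_one, mul_one]
  set B : ℝ≥0 := A * s + A * s with hB
  have hlim : Tendsto (fun t : ℝ≥0 => (B : ℝ≥0∞) / t) atTop (𝓝 0) := by
    have := ENNReal.Tendsto.const_div (a := (B : ℝ≥0∞))
      (ENNReal.tendsto_coe_nhds_top.2 (tendsto_id (α := ℝ≥0) (x := atTop)))
      (Or.inr ENNReal.coe_ne_top)
    simpa using this
  have hlow : Tendsto (fun t : ℝ≥0 => L 0 0 - (B : ℝ≥0∞) / t) atTop (𝓝 (L 0 0)) := by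
    simpa using ENNReal.Tendsto.sub tendsto_const_nhds hlim (Or.inl hLt)
  have hup : Tendsto (fun t : ℝ≥0 => L 0 0 + (B : ℝ≥0∞) / t) atTop (𝓝 (L 0 0)) := by
    simpa using tendsto_const_nhds.add hlim
  refine tendsto_of_tendsto_of_tendsto_of_le_of_le' hlow hup ?_ ?_
  -- Lower bound: returning from `y` to `x` in time `s` closes the path into a loop of duration `t +
  -- s`.
  · filter_upwards [eventually_gt_atTop 0] with t ht
    have ht0 : (t : ℝ≥0∞) ≠ 0 := by exact_mod_cast ht.ne'
    rw [tsub_le_iff_right, ← ENNReal.add_div, ENNReal.le_div_iff_mul_le (Or.inl ht0)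
      (Or.inl ENNReal.coe_ne_top)]
    calc L 0 0 * t ≤ L 0 0 * (t + s : ℝ≥0) := by gcongr; exact le_self_add
      _ = I (t + s) (SkorohodSpace.zeroPath d (t + s)) :=
        (rate_zeroPath hI h0 (add_pos ht hs')).symm
      _ ≤ minimalAction (limitCone E) I (t + s) x x :=
        hA.rate_zeroPath_le_minimalAction hne (add_pos ht hs') x
      _ ≤ minimalAction (limitCone E) I t x y + minimalAction (limitCone E) I s y x :=
        minimalAction_add_le hI ht hs' x y x
      _ ≤ minimalAction (limitCone E) I t x y + B := by
        gcongr
        refine m3.trans ?_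
        rw [hB, ENNReal.coe_add, ENNReal.coe_mul]
        exact le_self_add
  · filter_upwards [eventually_gt_atTop ((s : ℝ≥0) + s)] with t ht
    have htpos : 0 < t := lt_of_le_of_lt zero_le ht
    have ht0 : (t : ℝ≥0∞) ≠ 0 := by exact_mod_cast htpos.ne'
    obtain ⟨r, hr, rfl⟩ : ∃ r : ℝ≥0, 0 < r ∧ t = s + r + s := by
      refine ⟨t - (s + s), tsub_pos_of_lt ht, ?_⟩
      rw [add_right_comm, add_tsub_cancel_of_le ht.le]
    rw [ENNReal.div_le_iff ht0 ENNReal.coe_ne_top, add_mul,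
      ENNReal.div_mul_cancel ht0 ENNReal.coe_ne_top]
    calc minimalAction (limitCone E) I (s + r + s) x y
        ≤ minimalAction (limitCone E) I s x 0 + minimalAction (limitCone E) I r 0 0 +
          minimalAction (limitCone E) I s 0 y :=
          (minimalAction_add_le hI (add_pos hs' hr) hs' x 0 y).trans
            (add_le_add_left (minimalAction_add_le hI hs' hr x 0 0) _)
      _ ≤ A * (s : ℝ≥0) + L 0 0 * r + A * (s : ℝ≥0) := by
          gcongr
          exact minimalAction_zero_le hI h0 hr
      _ = L 0 0 * r + B := by rw [hB, ENNReal.coe_add, ENNReal.coe_mul]; ring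
      _ ≤ L 0 0 * (s + r + s : ℝ≥0) + B := by
          gcongr
          rw [add_right_comm]; exact le_add_self

end LargeDeviationAssumption

/-! ### The Markov property and the spectral radius -/

namespace StrongMarkovProcess

variable {d : ℕ} {E : Set (EuclideanSpace ℝ (Fin d))} {Ω : Type*} [MeasurableSpace Ω]
  (Y : StrongMarkovProcess E Ω)

/-- The strong Markov property at the constant stopping time `s`. -/
theorem law_inter_eq_lintegral (x : E) (s t : ℝ≥0) {A B : Set E} (hA : MeasurableSet A)
    (hB : MeasurableSet B) :
    Y.law x ({ω | Y.X s ω ∈ A} ∩ {ω | Y.X (s + t) ω ∈ B}) =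
      ∫⁻ ω in {ω | Y.X s ω ∈ A}, Y.law (Y.X s ω) {ω' | Y.X t ω' ∈ B} ∂(Y.law x) := by
  have hτ := isStoppingTime_const
    (Filtration.natural Y.X fun t => (Y.measurable_X t).stronglyMeasurable) s
  have hmeas : MeasurableSet[hτ.measurableSpace] {ω | Y.X s ω ∈ A} := by
    rw [IsStoppingTime.measurableSpace_const]
    exact (Filtration.stronglyAdapted_natural
      (fun t => (Y.measurable_X t).stronglyMeasurable) s).measurable hA
  have hs : ((s : WithTop ℝ≥0) < ⊤) = True := eq_true (WithTop.coe_lt_top s)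
  have h := Y.strong_markov x _ hτ {ω | Y.X s ω ∈ A} hmeas t B hB
  simp only [hs, WithTop.untopD_coe, true_and, ofPred_true, inter_univ] at h
  exact h

theorem pow_le_law {B : Set E} (hB : MeasurableSet B) {s : ℝ≥0} {q : ℝ≥0∞}
    (hq : ∀ e ∈ B, q ≤ Y.law e {ω | Y.X s ω ∈ B}) (n : ℕ) :
    ∀ e ∈ B, q ^ (n + 1) ≤ Y.law e {ω | Y.X ((n + 1 : ℕ) * s) ω ∈ B} := by
  induction n with
  | zero => simpa using hq
  | succ n ih =>
    intro e he
    have hs : ((n + 1 + 1 : ℕ) : ℝ≥0) * s = s + (n + 1 : ℕ) * s := by push_cast; ring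
    have hmeas : MeasurableSet {ω | Y.X s ω ∈ B} := Y.measurable_X s hB
    calc q ^ (n + 1 + 1) = q ^ (n + 1) * q := pow_succ _ _
      _ ≤ q ^ (n + 1) * Y.law e {ω | Y.X s ω ∈ B} := by gcongr; exact hq e he
      _ = ∫⁻ _ in {ω | Y.X s ω ∈ B}, q ^ (n + 1) ∂(Y.law e) := (setLIntegral_const _ _).symm
      _ ≤ ∫⁻ ω in {ω | Y.X s ω ∈ B},
            Y.law (Y.X s ω) {ω' | Y.X ((n + 1 : ℕ) * s) ω' ∈ B} ∂(Y.law e) :=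
          setLIntegral_mono' hmeas fun ω hω => ih _ hω
      _ = Y.law e ({ω | Y.X s ω ∈ B} ∩ {ω | Y.X (s + (n + 1 : ℕ) * s) ω ∈ B}) :=
          (Y.law_inter_eq_lintegral e s _ hB hB).symm
      _ ≤ _ := by rw [hs]; exact measure_mono inter_subset_right

theorem resolvent_le_of_law_le {r c B : ℝ} (hr : 0 < r) {W : Set E} {x : E}
    (h : ∀ t > 0, Y.law x {ω | Y.X t.toNNReal ω ∈ W} ≤ ENNReal.ofReal (B * Real.exp (-(c * t)))) :
    Y.resolvent r W x ≤
      ∫⁻ t in Ioi (0 : ℝ), ENNReal.ofReal (B * Real.exp (-(Real.log r + c) * t)) := by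
  refine setLIntegral_mono' measurableSet_Ioi fun t ht => ?_
  refine (mul_le_mul_right (h t ht) _).trans_eq ?_
  rw [← ENNReal.ofReal_mul (Real.rpow_nonneg hr.le _), Real.rpow_def_of_pos hr, mul_left_comm,
    ← Real.exp_add]
  congr 3
  ring

/-- From time `max 0 t₀` on the integrand is at least `1`. -/
theorem resolvent_eq_top_of_le_law {r c t₀ : ℝ} (hr : 0 < r) (hc : Real.log r ≤ -c) {W : Set E}
    {x : E} (h : ∀ t ≥ t₀, ENNReal.ofReal (Real.exp (-(c * t))) ≤
      Y.law x {ω | Y.X t.toNNReal ω ∈ W}) :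
    Y.resolvent r W x = ∞ := by
  refine top_unique ?_
  calc ∞ = ∫⁻ _ in Ioi (max 0 t₀), (1 : ℝ≥0∞) := by simp
    _ ≤ ∫⁻ t in Ioi (max 0 t₀), ENNReal.ofReal (r ^ (-t)) *
          Y.law x {ω | Y.X t.toNNReal ω ∈ W} := by
        refine setLIntegral_mono' measurableSet_Ioi fun t ht => ?_
        have ht0 : 0 ≤ t := (le_max_left _ _).trans (le_of_lt ht)
        refine le_trans ?_ (mul_le_mul_right (h t ((le_max_right _ _).trans (le_of_lt ht))) _)
        rw [← ENNReal.ofReal_mul (Real.rpow_nonneg hr.le _), Real.rpow_def_of_pos hr,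
          ← Real.exp_add, ENNReal.one_le_ofReal, Real.one_le_exp_iff]
        nlinarith
    _ ≤ Y.resolvent r W x :=
        lintegral_mono_set (Ioi_subset_Ioi (le_max_left _ _))

/-- A Cauchy–Hadamard argument. If `-log r < i`, a rate `c` in between makes the resolvent bounded
on `K`; if `i < -log r`, a rate in between makes it infinite on a set of positive measure. -/
theorem spectralRadius_eq_of_law_bounds (m : Measure E) [IsFiniteMeasureOnCompacts m] {i : ℝ}
    (hup : ∀ c < i, ∀ K W : Set E, IsCompact K → IsCompact W → ∃ t₀ : ℝ, ∀ t ≥ t₀, ∀ e ∈ K,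
      Y.law e {ω | Y.X t.toNNReal ω ∈ W} ≤ ENNReal.ofReal (Real.exp (-(c * t))))
    (hlow : ∀ c > i, ∃ K W : Set E, IsCompact K ∧ IsCompact W ∧ m K ≠ 0 ∧ ∃ t₀ : ℝ, ∀ t ≥ t₀,
      ∀ e ∈ K, ENNReal.ofReal (Real.exp (-(c * t))) ≤ Y.law e {ω | Y.X t.toNNReal ω ∈ W}) :
    Y.spectralRadius m = ENNReal.ofReal (Real.exp (-i)) := by
  have := Y.isMarkovKernel_law
  refine le_antisymm ?_ (le_iInf₂ fun r hr => ?_)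
  · refine ge_of_tendsto (x := 𝓝[>] (Real.exp (-i))) (f := ENNReal.ofReal)
      ((ENNReal.continuous_ofReal.tendsto _).mono_left nhdsWithin_le_nhds) ?_
    filter_upwards [self_mem_nhdsWithin] with r hr
    have hr0 : 0 < r := (Real.exp_pos _).trans hr
    refine iInf₂_le r ⟨hr0, fun W hW K hK => ?_⟩
    have hlog : -Real.log r < i := by
      have := (Real.lt_log_iff_exp_lt hr0).2 hr
      linarith
    obtain ⟨c, hc1, hc2⟩ := exists_between hlog
    obtain ⟨t₀, ht₀⟩ := hup c hc2 K W hK hW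
    -- This constant covers the times before `t₀`, where only the trivial bound `1` is available.
    set B : ℝ := Real.exp (|c| * |t₀|) with hB
    have hbound : ∀ e ∈ K, ∀ t > 0, Y.law e {ω | Y.X t.toNNReal ω ∈ W} ≤
        ENNReal.ofReal (B * Real.exp (-(c * t))) := by
      intro e he t ht
      rcases le_or_gt t₀ t with h | h
      · refine (ht₀ t h e he).trans (ENNReal.ofReal_le_ofReal ?_)
        exact le_mul_of_one_le_left (Real.exp_pos _).le (Real.one_le_exp (by positivity))
      · refine prob_le_one.trans ?_
        rw [hB, ← Real.exp_add, ENNReal.one_le_ofReal, Real.one_le_exp_iff]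
        have h1 : c * t ≤ |c| * |t₀| := by
          refine (le_abs_self _).trans ?_
          rw [abs_mul]
          gcongr
        linarith
    have hint : ∫⁻ t in Ioi (0 : ℝ), ENNReal.ofReal (B * Real.exp (-(Real.log r + c) * t)) < ∞ :=
      ((exp_neg_integrableOn_Ioi 0 (by linarith)).const_mul B).lintegral_lt_top
    calc ∫⁻ x in K, Y.resolvent r W x ∂m
        ≤ ∫⁻ _ in K, (∫⁻ t in Ioi (0 : ℝ),
            ENNReal.ofReal (B * Real.exp (-(Real.log r + c) * t))) ∂m :=
          setLIntegral_mono' hK.measurableSet fun e he =>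
            Y.resolvent_le_of_law_le hr0 (hbound e he)
      _ = _ := setLIntegral_const _ _
      _ < ∞ := ENNReal.mul_lt_top hint hK.measure_lt_top
  · obtain ⟨hr0, hfin⟩ := hr
    refine ENNReal.ofReal_le_ofReal ?_
    by_contra! hlt
    have hlog : i < -Real.log r := by
      have := (Real.log_lt_iff_lt_exp hr0).2 hlt
      linarith
    obtain ⟨c, hc1, hc2⟩ := exists_between hlog
    obtain ⟨K, W, hK, hW, hmK, t₀, ht₀⟩ := hlow c hc1
    refine (hfin W hW K hK).ne ?_
    rw [setLIntegral_congr_fun (g := fun _ => ∞) hK.measurableSet fun e he =>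
      Y.resolvent_eq_top_of_le_law hr0 (by linarith) fun t ht => ht₀ t ht e he,
      setLIntegral_const, ENNReal.top_mul hmK]

end StrongMarkovProcess

/-! ### Exponential decay of the return probabilities -/

namespace LargeDeviationAssumption

variable {d : ℕ} {E : Set (EuclideanSpace ℝ (Fin d))} {Ω : Type*} [MeasurableSpace Ω]
  {Y : StrongMarkovProcess E Ω} {I : (T : ℝ≥0) → SkorohodSpace d T → ℝ≥0∞}

theorem rate_zeroPath_ne_top (hA : LargeDeviationAssumption Y I) (hne : E.Nonempty) :
    I 1 (SkorohodSpace.zeroPath d 1) ≠ ∞ := by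
  obtain ⟨L, hI, ρ, hρ, A, hL⟩ := hA.exists_lagrangian
  rw [rate_zeroPath hI (zero_mem_limitCone hne) one_pos, ENNReal.coe_one, mul_one]
  exact ne_top_of_le_ne_top ENNReal.coe_ne_top
    (hL 0 (zero_mem_limitCone hne) 0 (by simpa using hρ.le))

theorem law_mem_compact_le (hA : LargeDeviationAssumption Y I) (hne : E.Nonempty) {c : ℝ}
    (hc : c < (I 1 (SkorohodSpace.zeroPath d 1)).toReal) {K W : Set E} (hK : IsCompact K)
    (hW : IsCompact W) :
    ∃ t₀ : ℝ, ∀ t ≥ t₀, ∀ e ∈ K,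
      Y.law e {ω | Y.X t.toNNReal ω ∈ W} ≤ ENNReal.ofReal (Real.exp (-(c * t))) := by
  have := Y.isMarkovKernel_law
  rcases lt_or_ge c 0 with hc0 | hc0
  · refine ⟨0, fun t ht e _ => prob_le_one.trans ?_⟩
    rw [ENNReal.one_le_ofReal, Real.one_le_exp_iff]
    nlinarith
  lift c to ℝ≥0 using hc0
  have hlt : (c : ℝ≥0∞) < I 1 (SkorohodSpace.zeroPath d 1) := by
    rw [← ENNReal.ofReal_toReal (hA.rate_zeroPath_ne_top hne), ← ENNReal.ofReal_coe_nnreal]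
    exact (ENNReal.ofReal_lt_ofReal_iff_of_nonneg c.2).2 hc
  obtain ⟨c', h1, h2⟩ := ENNReal.lt_iff_exists_nnreal_btwn.1 hlt
  have hc' : 0 < c' := by
    have : c < c' := by exact_mod_cast h1
    exact lt_of_le_of_lt zero_le this
  obtain ⟨L, hI, -⟩ := hA.exists_lagrangian
  -- A path of cost at most `c'` from `0` cannot return to `0`, since it would be a loop cheaper
  -- than the zero path; by compactness all these paths end at distance more than `δ` from `0`.
  obtain ⟨δ, hδ, hδK⟩ := (hA.good 1 one_pos c' hc' {0}
    isCompact_singleton).exists_pos_lt_of_continuous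
    (f := fun ψ => ‖ψ.finish‖ₑ) SkorohodSpace.continuous_finish.enorm (by
      rintro φ ⟨hφ0, hφ⟩ hfin
      have hφt : integralFunctional (limitCone E) L φ ≠ ∞ := by
        rw [← hI 1 one_pos]
        exact ne_top_of_le_ne_top ENNReal.coe_ne_top hφ
      obtain ⟨hac, hφC, -⟩ := SkorohodSpace.integralFunctional_of_continuous hφt
      have hcont : Continuous φ.toFun := by
        have h := hac.continuousOn
        rw [uIcc_of_le (NNReal.coe_nonneg _)] at h
        refine (continuousOn_iff_continuous_domRestrict.1 h).congr fun t => ?_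
        exact φ.extend_of_mem t.2
      have hloop : φ.start = φ.finish := by
        rw [enorm_eq_zero.1 hfin]
        exact hφ0
      exact absurd ((hA.rate_zeroPath_le_of_loop hne one_pos hcont hφC hloop).trans hφ)
        (not_le.2 h2))
  obtain ⟨ε, hε, hup⟩ := (hA.ldp 1 one_pos).eventually_le_exp (x := 0)
    (F := {φ | ‖φ.finish‖ₑ ≤ δ})
    (isClosed_le SkorohodSpace.continuous_finish.enorm continuous_const) (c := c) (by
      refine h1.trans_le (le_iInf₂ fun χ hχ => ?_)
      by_contra! hlt'
      exact absurd (hδK χ ⟨hχ.2, hlt'.le⟩) (not_lt.2 hχ.1))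
  obtain ⟨R₁, hR₁⟩ := (hK.image continuous_subtype_val).isBounded.exists_norm_le
  obtain ⟨R₂, hR₂⟩ := (hW.image continuous_subtype_val).isBounded.exists_norm_le
  -- The scale is `a = t` on the time interval `[0,1]`; for large `t` the set `K / t` lies in the
  -- `ε`-ball and `W / t` in the `δ`-ball.
  obtain ⟨t₀, ht₀⟩ := eventually_atTop.1 (hup.and ((eventually_gt_atTop (0 : ℝ)).and
    ((eventually_gt_atTop (R₁ / ε)).and (eventually_gt_atTop (R₂ / δ)))))
  refine ⟨t₀, fun t ht e he => ?_⟩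
  obtain ⟨hup, ht0, hte, htδ⟩ := ht₀ t ht
  have hδ' : (0 : ℝ) < δ := hδ
  rw [div_lt_iff₀ hε] at hte
  rw [div_lt_iff₀ hδ'] at htδ
  refine le_trans (measure_mono fun ω hω => ?_) (hup e ?_)
  · have hfin : (Y.rescaled t 1 ω).finish =
        t⁻¹ • (Y.X t.toNNReal ω : EuclideanSpace ℝ (Fin d)) := by
      simp [SkorohodSpace.finish, StrongMarkovProcess.rescaled]
    simp only [mem_ofPred_eq]
    rw [hfin, ← ofReal_norm, ← ENNReal.ofReal_coe_nnreal]
    refine ENNReal.ofReal_le_ofReal ?_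
    rw [norm_smul, norm_inv, Real.norm_of_nonneg ht0.le, inv_mul_le_iff₀ ht0]
    exact (hR₂ _ (mem_image_of_mem _ hω)).trans htδ.le
  · rw [sub_zero, norm_smul, norm_inv, Real.norm_of_nonneg ht0.le, inv_mul_lt_iff₀ ht0]
    exact (hR₁ _ (mem_image_of_mem _ he)).trans_lt hte

theorem exists_eventually_le_law_closedBall (hA : LargeDeviationAssumption Y I)
    (hne : E.Nonempty) {c : ℝ} (hc : (I 1 (SkorohodSpace.zeroPath d 1)).toReal < c) :
    ∃ T : ℝ≥0, 0 < T ∧ ∀ᶠ a : ℝ in atTop, ∀ e : E, ‖(e : EuclideanSpace ℝ (Fin d))‖ ≤ a →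
      ENNReal.ofReal (Real.exp (-(c * (a * T)))) ≤
        Y.law e {ω | ‖(Y.X (a * T).toNNReal ω : EuclideanSpace ℝ (Fin d))‖ ≤ a} := by
  obtain ⟨L, hI, ρ, hρ, A, hL⟩ := hA.exists_lagrangian
  have h0 := zero_mem_limitCone hne
  have hC := convex_limitCone hA.convex_cone
  have hL0 : L 0 0 ≠ ∞ := ne_top_of_le_ne_top ENNReal.coe_ne_top (hL 0 h0 0 (by simpa using hρ.le))
  rw [rate_zeroPath hI h0 one_pos, ENNReal.coe_one, mul_one] at hc
  have hc0 : 0 ≤ c := ENNReal.toReal_nonneg.trans hc.le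
  lift c to ℝ≥0 using hc0
  obtain ⟨l, hl⟩ : ∃ l : ℝ≥0, L 0 0 = l := ⟨(L 0 0).toNNReal, (ENNReal.coe_toNNReal hL0).symm⟩
  rw [hl, ENNReal.coe_toReal] at hc
  obtain ⟨s, hs⟩ := exists_nat_gt (1 / ρ)
  have hs0 : (0 : ℝ) < s := lt_of_le_of_lt (by positivity) hs
  have hs' : (0 : ℝ≥0) < s := by exact_mod_cast hs0
  -- Reaching the origin in time `s` costs up to `A * s`, possibly above the rate `c`; waiting there
  -- for a time `n` at the rate `l < c` makes up for it.
  obtain ⟨n, hn⟩ := exists_nat_gt (A * s / (c - l) : ℝ)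
  have hn0 : (0 : ℝ) < n :=
    lt_of_le_of_lt (div_nonneg (by positivity) (sub_nonneg.2 hc.le)) hn
  have hn' : (0 : ℝ≥0) < n := by exact_mod_cast hn0
  set T : ℝ≥0 := s + n with hT
  have hT0 : 0 < T := add_pos hs' hn'
  have hbudget : A * s + l * n < c * T := by
    rw [← NNReal.coe_lt_coe, hT]
    push_cast
    rw [div_lt_iff₀ (sub_pos.2 hc)] at hn
    nlinarith [mul_nonneg c.2 hs0.le, NNReal.coe_nonneg c]
  refine ⟨T, hT0, ?_⟩
  have hK : IsCompact (Metric.closedBall (0 : EuclideanSpace ℝ (Fin d)) 1 ∩ limitCone E) :=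
    (isCompact_closedBall _ _).inter_right (isClosed_limitCone hne)
  -- The large deviation bound is uniform only near each starting point `y`; compactness of the unit
  -- ball of the cone yields one threshold for `a` valid for all of them.
  have hmem := hK.mem_prod_nhdsSet_of_forall (l := (atTop : Filter ℝ))
    (s := {p : ℝ × EuclideanSpace ℝ (Fin d) | 0 < p.1 ∧ ∀ e : E,
      p.1⁻¹ • (e : EuclideanSpace ℝ (Fin d)) = p.2 →
      ENNReal.ofReal (Real.exp (-(c * (p.1 * T)))) ≤
        Y.law e {ω | ‖(Y.X (p.1 * T).toNNReal ω : EuclideanSpace ℝ (Fin d))‖ ≤ p.1}}) (by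
    rintro y ⟨hy1, hyC⟩
    rw [mem_closedBall_zero_iff] at hy1
    have hact : minimalAction (limitCone E) I T y 0 < ((c * T : ℝ≥0) : ℝ≥0∞) := by
      refine lt_of_le_of_lt ?_ (ENNReal.coe_lt_coe.2 hbudget)
      refine (minimalAction_add_le hI hs' hn' y 0 0).trans ?_
      rw [ENNReal.coe_add, ENNReal.coe_mul, ENNReal.coe_mul, ← hl]
      gcongr
      · refine minimalAction_line_le hI hC hL hs' hyC h0 ?_
        rw [div_lt_iff₀ hρ] at hs
        rw [zero_sub, norm_neg, NNReal.coe_natCast]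
        linarith
      · exact minimalAction_zero_le hI h0 hn'
    obtain ⟨ε, hε, hlow⟩ := (hA.ldp T hT0).eventually_exp_le (x := y)
      (O := {φ | ‖φ.finish‖ < 1})
      (isOpen_lt SkorohodSpace.continuous_finish.norm continuous_const) (c := c * T) (by
        simp only [minimalAction, iInf_lt_iff] at hact
        obtain ⟨φ, ⟨-, -, hφ0, hφ1⟩, hφ⟩ := hact
        exact (iInf₂_le φ ⟨by simp [hφ1], hφ0⟩).trans_lt hφ)
    refine mem_of_superset (prod_mem_prod (hlow.and (eventually_gt_atTop 0))
      (Metric.ball_mem_nhds y hε)) ?_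
    rintro ⟨a, z⟩ ⟨⟨ha, ha0⟩, hz⟩
    refine ⟨ha0, fun e he => ?_⟩
    have h := ha e (by
      simp only at he
      rw [he, ← dist_eq_norm]; exact hz)
    rw [NNReal.coe_mul, mul_assoc, mul_comm (T : ℝ) a] at h
    refine h.trans (measure_mono fun ω hω => ?_)
    have hfin : (Y.rescaled a T ω).finish =
        a⁻¹ • (Y.X (a * T).toNNReal ω : EuclideanSpace ℝ (Fin d)) := rfl
    simp only [mem_ofPred_eq] at hω ⊢
    rw [hfin, norm_smul, norm_inv, Real.norm_of_nonneg (le_of_lt ha0),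
      inv_mul_lt_iff₀ ha0, mul_one] at hω
    exact hω.le)
  obtain ⟨U, hU, V, hV, hUV⟩ := mem_prod_iff.1 hmem
  filter_upwards [hU, eventually_gt_atTop 0] with a haU ha0 e he
  refine (hUV (mk_mem_prod haU (subset_of_mem_nhdsSet hV ⟨?_, smul_mem_limitCone
    (hA.subset_cone e.2) (inv_nonneg.2 ha0.le)⟩))).2 e rfl
  rw [mem_closedBall_zero_iff, norm_smul, norm_inv, Real.norm_of_nonneg ha0.le,
    inv_mul_le_iff₀ ha0, mul_one]
  exact he

theorem exists_compact_le_law (hA : LargeDeviationAssumption Y I) (hE : IsClosed E)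
    (hne : E.Nonempty) (m : Measure E) [m.IsOpenPosMeasure] {c : ℝ}
    (hc : (I 1 (SkorohodSpace.zeroPath d 1)).toReal < c) :
    ∃ K W : Set E, IsCompact K ∧ IsCompact W ∧ m K ≠ 0 ∧ ∃ t₀ : ℝ, ∀ t ≥ t₀, ∀ e ∈ K,
      ENNReal.ofReal (Real.exp (-(c * t))) ≤ Y.law e {ω | Y.X t.toNNReal ω ∈ W} := by
  obtain ⟨T, hT, hev⟩ := hA.exists_eventually_le_law_closedBall hne hc
  have hT' : (0 : ℝ) < T := hT
  obtain ⟨z, hz⟩ := hne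
  obtain ⟨a₀, ha₀⟩ := eventually_atTop.1 (hev.and (eventually_gt_atTop ‖z‖))
  have hza : ‖z‖ < a₀ := (ha₀ a₀ le_rfl).2
  have ha₀0 : 0 < a₀ := (norm_nonneg z).trans_lt hza
  have hcomp : ∀ R : ℝ, IsCompact {e : E | ‖(e : EuclideanSpace ℝ (Fin d))‖ ≤ R} := fun R => by
    have := hE.isClosedEmbedding_subtypeVal.isCompact_preimage
      (isCompact_closedBall (0 : EuclideanSpace ℝ (Fin d)) R)
    convert this using 1
    ext e
    simp
  refine ⟨_, _, hcomp a₀, hcomp (2 * a₀), fun hm => ?_, a₀ * T, fun t ht e he => ?_⟩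
  · have hopen : IsOpen {e : E | ‖(e : EuclideanSpace ℝ (Fin d))‖ < a₀} :=
      isOpen_lt continuous_subtype_val.norm continuous_const
    exact hopen.measure_ne_zero m ⟨⟨z, hz⟩, hza⟩
      (measure_mono_null (fun e (he : ‖(e : EuclideanSpace ℝ (Fin d))‖ < a₀) => he.le) hm)
  · have hq : 0 < a₀ * T := mul_pos ha₀0 hT'
    have h1 : 1 ≤ t / (a₀ * T) := (one_le_div hq).2 ht
    obtain ⟨n, hn⟩ : ∃ n, ⌊t / (a₀ * T)⌋₊ = n + 1 :=
      Nat.exists_eq_succ_of_ne_zero (Nat.floor_pos.2 h1).ne'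
    have hn1 : ((n + 1 : ℕ) : ℝ) * (a₀ * T) ≤ t := by
      rw [← hn, ← le_div_iff₀ hq]; exact Nat.floor_le (zero_le_one.trans h1)
    have hn2 : t < ((n + 1 : ℕ) + 1 : ℝ) * (a₀ * T) := by
      rw [← hn, ← div_lt_iff₀ hq]; exact Nat.lt_floor_add_one _
    have hN : (0 : ℝ) < (n + 1 : ℕ) := by positivity
    -- The scale is tuned so that `t` is an exact multiple of `a * T`. Rounding down keeps `a`
    -- between `a₀` and `2 * a₀`, so one compact target serves all `t`.
    set a : ℝ := t / ((n + 1 : ℕ) * T) with ha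
    have hNT : 0 < ((n + 1 : ℕ) : ℝ) * T := mul_pos hN hT'
    have hat : ((n + 1 : ℕ) : ℝ) * (a * T) = t := by rw [ha]; field_simp
    have ha1 : a₀ ≤ a := by rw [ha, le_div_iff₀ hNT]; linarith
    have ha2 : a ≤ 2 * a₀ := by
      rw [ha, div_le_iff₀ hNT]
      have : (1 : ℝ) ≤ (n + 1 : ℕ) := by push_cast; linarith [Nat.cast_nonneg (α := ℝ) n]
      nlinarith
    have hpow := Y.pow_le_law (s := (a * T).toNNReal) (hcomp a).measurableSet
      (fun e he => (ha₀ a ha1).1 e he) n e (le_trans he ha1)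
    have htime : ((n + 1 : ℕ) : ℝ≥0) * (a * T).toNNReal = t.toNNReal := by
      rw [← hat, Real.toNNReal_mul hN.le, Real.toNNReal_natCast]
    rw [htime, ← ENNReal.ofReal_pow (Real.exp_pos _).le, ← Real.exp_nat_mul] at hpow
    have hexp : ((n + 1 : ℕ) : ℝ) * -(c * (a * T)) = -(c * t) := by rw [← hat]; ring
    rw [hexp] at hpow
    exact hpow.trans (measure_mono fun ω hω => le_trans hω ha2)

end LargeDeviationAssumption

theorem theorem1 {d : ℕ} (E : Set (EuclideanSpace ℝ (Fin d))) (hE : IsClosed E)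
    (hE' : ¬ Bornology.IsBounded E)
    (m : Measure E) [m.Regular] [m.IsOpenPosMeasure]
    {Ω : Type*} [MeasurableSpace Ω] (Y : StrongMarkovProcess E Ω)
    (I : (T : ℝ≥0) → SkorohodSpace d T → ℝ≥0∞) (hA : LargeDeviationAssumption Y I)
    (x y : EuclideanSpace ℝ (Fin d)) (hx : x ∈ limitCone E) (hy : y ∈ limitCone E) :
    ENNReal.log (Y.spectralRadius m) = -(minimalAction (limitCone E) I 1 0 0 : EReal) ∧
    minimalAction (limitCone E) I 1 0 0 = I 1 (SkorohodSpace.zeroPath d 1) ∧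
    I 1 (SkorohodSpace.zeroPath d 1) =
      limsup (fun t : ℝ≥0 => minimalAction (limitCone E) I t x y / t) atTop ∧
    limsup (fun t : ℝ≥0 => minimalAction (limitCone E) I t x y / t) atTop =
      ⨅ (φ : SkorohodSpace d 1)
        (_ : Continuous φ.toFun ∧ (∀ s, φ s ∈ limitCone E) ∧ φ.start = φ.finish),
        I 1 φ := by
  have hne : E.Nonempty := by
    rw [nonempty_iff_ne_empty]
    rintro rfl
    exact hE' Bornology.isBounded_empty
  have hzero := hA.minimalAction_zero_eq hne one_pos
  have hlim := (hA.tendsto_minimalAction_div hne hx hy).limsup_eq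
  refine ⟨?_, hzero, hlim.symm, hlim.trans (le_antisymm ?_ ?_)⟩
  · rw [hzero, Y.spectralRadius_eq_of_law_bounds m
      (fun c hc K W hK hW => hA.law_mem_compact_le hne hc hK hW)
      (fun c hc => hA.exists_compact_le_law hE hne m hc),
      ENNReal.log_ofReal_of_pos (Real.exp_pos _), Real.log_exp, EReal.coe_neg,
      EReal.coe_ennreal_toReal (hA.rate_zeroPath_ne_top hne)]
  · exact le_iInf₂ fun φ h => hA.rate_zeroPath_le_of_loop hne one_pos h.1 h.2.1 h.2.2
  · exact iInf₂_le _ ⟨continuous_const, fun _ => zero_mem_limitCone hne, rfl⟩
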